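/- Let $k$ be an infinite field and $R=k[x_0,\dots,x_n]$ with the standard grading. Let $c,s$ be integers with $1\le c\le\min(n,s)$, and let $f_1,\dots,f_s\in R$ be homogeneous of degrees $d_1,\dots,d_s\ge 1$, defining hypersurfaces $F_1,\dots,F_s\subset\mathbb P^n$ (not necessarily reduced). Assume that the intersection of any $c+1$ of these hypersurfaces has codimension $c+1$ (where the empty set has codimension $n+1$); if $s=c$, assume instead that $F_1\cap\dots\cap F_c$ has codimension $c$. Write $\lambda=[d_1,\dots,d_s]$, $\lambda'=[d_1,\dots,d_{s-1}]$. Let $V_{\lambda,c}\subset\mathbb P^n$ be the scheme-theoretic union of all the codimension $c$ complete intersection subschemes $F_{i_1}\cap\dots\cap F_{i_c}$, $1\le i_1<\dots<i_c\le s$, and define $V_{\lambda',c}$ and $V_{\lambda',c-1}$ in the same way from $F_1,\dots,F_{s-1}$; here $V_{\lambda',0}=\mathbb P^n$, and $V_{\lambda',c}=\varnothing$ if $s=c$. For a closed subscheme $V\subset\mathbb P^n$ let $I_V\subset R$ be its saturated ideal and $h_V(t)=\dim_k[R/I_V]_t$ for $t\in\mathbb Z$ (so $h_V(t)=0$ for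 $t<0$). Then: 1. $V_{\lambda,c}$ is arithmetically Cohen–Macaulay, i.e. $R/I_{V_{\lambda,c}}$ is a Cohen–Macaulay ring. 2. For all $t\in\mathbb Z$, $$h_{V_{\lambda,c}}(t)=\bigl[h_{V_{\lambda',c-1}}(t)-h_{V_{\lambda',c-1}}(t-d_s)\bigr]+h_{V_{\lambda',c}}(t-d_s).$$ 3. $\displaystyle \deg V_{\lambda,c}=\sum_{1\le i_1<\dots<i_c\le s}d_{i_1}d_{i_2}\cdots d_{i_c}.$ 4. $I_{V_{\lambda,c}}$ is minimally generated by the products of $s-c+1$ of the forms: $$I_{V_{\lambda,c}}=\bigl(f_{i_1}f_{i_2}\cdots f_{i_{s-c+1}}\ \big|\ 1\le i_1<\dots<i_{s-c+1}\le s\bigr),$$ and none of these generators lies in the ideal generated by the others. -/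

import Mathlib

open MvPolynomial

noncomputable section

namespace HypersurfaceConfig

/-- The depth (grade) of an ideal `P` of a ring `A`: the supremum of the lengths of the
`A`-regular sequences all of whose entries lie in `P`. -/
def depth {A : Type*} [CommRing A] (P : Ideal A) : ℕ∞ :=
  ⨆ (rs : List A) (_ : ∀ r ∈ rs, r ∈ P) (_ : RingTheory.Sequence.IsRegular A rs),
    (rs.length : ℕ∞)

/-- A Cohen-Macaulay ring: a Noetherian ring in which `depth P = height P` for every maximal
ideal `P`. -/
structure IsCohenMacaulayRing (A : Type*) [CommRing A] : Prop where
  isNoetherianRing : IsNoetherianRing A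
  depth_eq_height : ∀ P : Ideal A, P.IsMaximal → depth P = P.height

variable {k : Type*} [Field k] {n : ℕ}

/-- The irrelevant ideal `(x_0, …, x_n)` of `k[x_0, …, x_n]`. -/
def irrelevantIdeal (k : Type*) [Field k] (n : ℕ) : Ideal (MvPolynomial (Fin (n + 1)) k) :=
  Ideal.span (Set.range X)

/-- The saturation `⋃ₘ (I : 𝔪 ^ m)` of `I` with respect to the irrelevant ideal `𝔪`. For a
homogeneous ideal `I` it is the saturated ideal `I_V` of the closed subscheme `V` of `ℙⁿ` that
`I` defines, and `V ↦ I_V` identifies closed subschemes of `ℙⁿ` with saturated homogeneous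
ideals. -/
def saturation (I : Ideal (MvPolynomial (Fin (n + 1)) k)) :
    Ideal (MvPolynomial (Fin (n + 1)) k) :=
  ⨆ m : ℕ, Submodule.colon I ((irrelevantIdeal k n ^ m : Ideal _) : Set _)

/-- The ideal `(f_i : i ∈ A)`, defining the intersection of the hypersurfaces `F_i`, `i ∈ A`. -/
def intersectionIdeal (f : ℕ → MvPolynomial (Fin (n + 1)) k) (A : Finset ℕ) :
    Ideal (MvPolynomial (Fin (n + 1)) k) :=
  Ideal.span (f '' (A : Set ℕ))

/-- The saturated ideal of the configuration `V_{λ,c}` of the hypersurfaces `F_1, …, F_s` given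
by `f 1, …, f s`: `V_{λ,c}` is the scheme-theoretic union, over all `c`-element subsets `A` of
`{1, …, s}`, of the subschemes `⋂_{i ∈ A} F_i`, so its saturated ideal is the intersection of
theirs. For `c = 0` the scheme is `ℙⁿ` (with ideal `0`) and for `s < c` it is empty (with the
unit ideal). Only the values `f 1, …, f s` matter. -/
def configIdeal (f : ℕ → MvPolynomial (Fin (n + 1)) k) (s c : ℕ) :
    Ideal (MvPolynomial (Fin (n + 1)) k) :=
  ⨅ A ∈ (Finset.Icc 1 s).powersetCard c, saturation (intersectionIdeal f A)

/-- The Hilbert function `t ↦ dim_k [R/I]_t`, where `[R/I]_t` is the image in `R/I` of the forms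
of degree `t`; it vanishes for `t < 0`. -/
def hilbertFunction (I : Ideal (MvPolynomial (Fin (n + 1)) k)) (t : ℤ) : ℤ :=
  if t < 0 then 0
  else Module.finrank k
    ((homogeneousSubmodule (Fin (n + 1)) k t.toNat).map (Ideal.Quotient.mkₐ k I).toLinearMap)

/-- The subscheme of `ℙⁿ` with saturated ideal `I` has degree `e`: its Hilbert polynomial, which
agrees with the Hilbert function in all large degrees, has the form
`e / r! * t ^ r + (terms of lower degree)`, where `r` is its degree. (For the empty scheme the
Hilbert polynomial is `0`, and `e = 0`.) -/
def HasDegree (I : Ideal (MvPolynomial (Fin (n + 1)) k)) (e : ℕ) : Prop :=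
  ∃ P : Polynomial ℚ,
    (∀ᶠ t : ℕ in Filter.atTop, (hilbertFunction I t : ℚ) = P.eval (t : ℚ)) ∧
      P.leadingCoeff * (P.natDegree.factorial : ℚ) = e

end HypersurfaceConfig

end

/-! The configuration is built one hypersurface at a time. For a set `T` of indices let `P_c(T)` be
the ideal generated by the products of `|T| + 1 - c` of the forms. Sorting the products by whether
they involve `a` gives `P_{c+1}(T ∪ {a}) = P_c(T) + f_a P_{c+1}(T)` (`productIdeal_insert`). This is
a basic double link `I = J + f K`, with `J ⊆ K` and `f` a nonzerodivisor modulo `J`, so there are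
exact sequences `0 → K/J → R/J → R/K → 0` and, by multiplication by `f`, `0 → K/J → R/J → R/I → 0`.

Induction along these links gives everything. `P_c(T)` is the intersection of the complete
intersection ideals (`sup_productIdeal_eq_iInf`). The depth of `R/P_c(T)` is at least `n + 1 - c`
(`extVanishes_productIdeal`), which yields saturation and, with a height bound, the Cohen-Macaulay
property. Counting dimensions gives the Hilbert function recursion, and its leading coefficients
give the degree. Depth is expressed by vanishing of `Ext` (Rees), which passes through short exact
sequences.

The codimension hypothesis enters only through `isRegularFamily_of_height_eq`: each form is a
nonzerodivisor modulo the ideal of any at most `c` others. This rests on the unmixedness of complete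
intersections at the irrelevant ideal. -/

namespace HypersurfaceConfig

/-! ### Depth as vanishing of `Ext`, and basic double links. -/

section Ext

open CategoryTheory Abelian RingTheory.Sequence

universe u

variable {R : Type u} [CommRing R]

/-- The vanishing of `Ext^i(R/P, M)` for all `i < r`; for finitely generated `M` over a Noetherian
ring with `P M ≠ M` it says that `P` contains an `M`-regular sequence of length `r`. -/
def ExtVanishes (P : Ideal R) (r : ℕ) (M : ModuleCat.{u} R) : Prop :=
  ∀ i < r, Subsingleton (Ext (ModuleCat.of R (R ⧸ P)) M i)

theorem ExtVanishes.mono {P : Ideal R} {r r' : ℕ} (h : r' ≤ r) {M : ModuleCat.{u} R}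
    (hM : ExtVanishes P r M) : ExtVanishes P r' M :=
  fun i hi ↦ hM i (hi.trans_le h)

theorem extVanishes_of_subsingleton (P : Ideal R) (r : ℕ) (M : ModuleCat.{u} R)
    [Subsingleton M] : ExtVanishes P r M := by
  intro i _
  refine subsingleton_of_forall_eq 0 fun x ↦ ?_
  have h0 : 𝟙 M = 0 := (ModuleCat.isZero_of_subsingleton M).eq_of_src _ _
  rw [← Ext.comp_mk₀_id x, h0, Ext.mk₀_zero, Ext.comp_zero]

theorem ExtVanishes.of_shortExact_X₃ {P : Ideal R} {r : ℕ} {S : ShortComplex (ModuleCat.{u} R)}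
    (hS : S.ShortExact) (h₁ : ExtVanishes P (r + 1) S.X₁) (h₂ : ExtVanishes P r S.X₂) :
    ExtVanishes P r S.X₃ := by
  intro i hi
  refine subsingleton_of_forall_eq 0 fun x ↦ ?_
  have := h₁ (i + 1) (by lia)
  have := h₂ i hi
  obtain ⟨y, rfl⟩ := Ext.covariant_sequence_exact₃ _ hS x rfl (Subsingleton.elim _ _)
  rw [Subsingleton.elim y 0, Ext.zero_comp]

theorem ExtVanishes.of_shortExact_X₁ {P : Ideal R} {r : ℕ} {S : ShortComplex (ModuleCat.{u} R)}
    (hS : S.ShortExact) (h₂ : ExtVanishes P (r + 1) S.X₂) (h₃ : ExtVanishes P r S.X₃) :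
    ExtVanishes P (r + 1) S.X₁ := by
  intro i hi
  refine subsingleton_of_forall_eq 0 fun x ↦ ?_
  have := h₂ i hi
  cases i with
  | zero =>
    have hm := hS.mono_f
    exact Ext.postcomp_mk₀_injective_of_mono _ S.f (Subsingleton.elim _ _)
  | succ i =>
    have := h₃ i (by lia)
    obtain ⟨y, rfl⟩ := Ext.covariant_sequence_exact₁ _ hS x (Subsingleton.elim _ _) rfl
    rw [Subsingleton.elim y 0, Ext.zero_comp]

/-- Depth along a basic double link `I = J + f K`. -/
theorem ExtVanishes.of_basicDoubleLink {P J K : Ideal R} {f : R} {r : ℕ} (hJK : J ≤ K)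
    (hf : ∀ g, f * g ∈ J → g ∈ J)
    (hJ : ExtVanishes P (r + 1) (ModuleCat.of R (R ⧸ J)))
    (hK : ExtVanishes P r (ModuleCat.of R (R ⧸ K))) :
    ExtVanishes P r (ModuleCat.of R (R ⧸ (J ⊔ Ideal.span {f} * K))) := by
  -- `0 → K/J → R/J → R/K → 0`: the kernel `K/J` gets the depth `r + 1` of `R/J`, one more than
  -- `R/K`.
  have h₁ := ExtVanishes.of_shortExact_X₁
    (LinearMap.shortExact_shortComplexKer (Submodule.factor_surjective hJK)) hJ hK
  have hle : J ≤ J ⊔ Ideal.span {f} * K := le_sup_left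
  -- Multiplication by `f` embeds `K/J` in `R/J`, since `f` is regular modulo `J`; its image is `(J
  -- + f K)/J`, so the cokernel is `R/(J + f K)`.
  let φ : LinearMap.ker (Submodule.factor hJK) →ₗ[R] R ⧸ J :=
    f • (LinearMap.ker (Submodule.factor hJK)).subtype
  let ψ : (R ⧸ J) →ₗ[R] R ⧸ (J ⊔ Ideal.span {f} * K) := Submodule.factor hle
  have hφψ : ∀ x, ψ (φ x) = 0 := by
    rintro ⟨x, hx⟩
    obtain ⟨x, rfl⟩ := Submodule.mkQ_surjective J x
    have hxK := hx
    rw [LinearMap.mem_ker, Submodule.factor_mk, Submodule.mkQ_apply,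
      Submodule.Quotient.mk_eq_zero] at hxK
    have : ψ (φ ⟨Submodule.mkQ J x, hx⟩) = Submodule.mkQ _ (f * x) := rfl
    rw [this, Submodule.mkQ_apply, Submodule.Quotient.mk_eq_zero]
    exact Ideal.mem_sup_right (Ideal.mul_mem_mul (Ideal.mem_span_singleton_self f) hxK)
  have hS : (ModuleCat.shortComplexOfCompEqZero φ ψ (LinearMap.ext hφψ)).ShortExact := by
    refine ModuleCat.shortComplex_shortExact _ ?_ ?_ (Submodule.factor_surjective hle)
    · intro y
      refine ⟨fun hy ↦ ?_, ?_⟩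
      · obtain ⟨y, rfl⟩ := Submodule.mkQ_surjective J y
        have hy : Submodule.mkQ (J ⊔ Ideal.span {f} * K) y = 0 := hy
        rw [Submodule.mkQ_apply, Submodule.Quotient.mk_eq_zero] at hy
        obtain ⟨j, hj, z, hz, rfl⟩ := Submodule.mem_sup.mp hy
        obtain ⟨g, hg, rfl⟩ := Ideal.mem_span_singleton_mul.mp hz
        refine ⟨⟨Submodule.mkQ J g, ?_⟩, ?_⟩
        · rwa [LinearMap.mem_ker, Submodule.factor_mk, Submodule.mkQ_apply,
            Submodule.Quotient.mk_eq_zero]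
        · change Submodule.mkQ J (f * g) = Submodule.mkQ J (j + f * g)
          rw [map_add, Submodule.mkQ_apply J j, (Submodule.Quotient.mk_eq_zero J).mpr hj, zero_add]
      · rintro ⟨x, rfl⟩
        exact hφψ x
    · refine (injective_iff_map_eq_zero φ).mpr ?_
      rintro ⟨x, hx⟩ h
      obtain ⟨x, rfl⟩ := Submodule.mkQ_surjective J x
      have h : Submodule.mkQ J (f * x) = 0 := h
      rw [Submodule.mkQ_apply, Submodule.Quotient.mk_eq_zero] at h
      exact Subtype.ext ((Submodule.Quotient.mk_eq_zero J).mpr (hf x h))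
  exact ExtVanishes.of_shortExact_X₃ hS h₁ (hJ.mono (Nat.le_succ r))

/-- Rees' theorem; `I ≤ P ≠ ⊤` supplies the condition `P M ≠ M` for `M = R/I`. -/
theorem ExtVanishes.exists_isRegular [IsNoetherianRing R] {P I : Ideal R} (hP : P ≠ ⊤)
    (hIP : I ≤ P) {r : ℕ} (h : ExtVanishes P r (ModuleCat.of R (R ⧸ I))) :
    ∃ rs : List R, rs.length = r ∧ (∀ x ∈ rs, x ∈ P) ∧ IsRegular (R ⧸ I) rs := by
  refine ModuleCat.exists_isRegular_of_exists_subsingleton_ext P r (ModuleCat.of R (R ⧸ I)) ?_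
    (ModuleCat.of R (R ⧸ P)) ?_ h
  · refine lt_top_iff_ne_top.mpr fun htop ↦ hP ?_
    have h1 : Submodule.mkQ I 1 ∈ P • (⊤ : Submodule R (R ⧸ I)) := by
      change _ ∈ P • (⊤ : Submodule R (ModuleCat.of R (R ⧸ I)))
      rw [htop]; trivial
    have h2 : P • (⊤ : Submodule R (R ⧸ I)) ≤ Submodule.map (Submodule.mkQ I) P := by
      refine Submodule.smul_le.mpr fun p hp m _ ↦ ?_
      obtain ⟨m, rfl⟩ := Submodule.mkQ_surjective I m
      exact ⟨p * m, P.mul_mem_right m hp, rfl⟩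
    obtain ⟨p, hp, hp1⟩ := h2 h1
    have := (Submodule.Quotient.eq I).mp hp1
    exact (Ideal.eq_top_iff_one P).mpr (by simpa using P.sub_mem hp (hIP this))
  · rw [Module.support_eq_zeroLocus, Ideal.annihilator_quotient]

theorem extVanishes_of_isWeaklyRegular [IsNoetherianRing R] {P : Ideal R} (hP : P ≠ ⊤)
    {rs : List R} (mem : ∀ x ∈ rs, x ∈ P) (reg : IsWeaklyRegular R rs) :
    ExtVanishes P rs.length (ModuleCat.of R R) := by
  have hlt : P • (⊤ : Submodule R R) < ⊤ := by
    rw [smul_eq_mul, Ideal.mul_top]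
    exact hP.lt_top
  refine ModuleCat.subsingleton_ext_of_exists_isRegular P (ModuleCat.of R (R ⧸ P)) ?_
    (ModuleCat.of R R) hlt rs mem ⟨reg, fun h ↦ hP ?_⟩
  · rw [Module.support_eq_zeroLocus, Ideal.annihilator_quotient]
  · have : (⊤ : Ideal R) ≤ P := by
      rw [h, smul_eq_mul, Ideal.mul_top]
      exact Ideal.span_le.mpr mem
    exact top_le_iff.mp this

theorem ExtVanishes.of_iso {P : Ideal R} {r : ℕ} {M N : ModuleCat.{u} R} (e : M ≅ N)
    (h : ExtVanishes P r M) : ExtVanishes P r N := by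
  intro i hi
  refine subsingleton_of_forall_eq 0 fun x ↦ ?_
  have := h i hi
  rw [← Ext.comp_mk₀_id x, ← e.inv_hom_id, ← Ext.mk₀_comp_mk₀, ← Ext.comp_assoc_of_third_deg_zero,
    Subsingleton.elim (x.comp (Ext.mk₀ e.inv) _) 0, Ext.zero_comp]

theorem ExtVanishes.quotient_bot {P : Ideal R} {r : ℕ} (h : ExtVanishes P r (ModuleCat.of R R)) :
    ExtVanishes P r (ModuleCat.of R (R ⧸ (⊥ : Ideal R))) :=
  h.of_iso (Submodule.quotEquivOfEqBot (⊥ : Submodule R R) rfl).symm.toModuleIso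

end Ext

/-! ### Associated primes, regular sequences and heights. -/

section AssociatedPrimes

open RingTheory.Sequence Pointwise

theorem exists_associatedPrime_le_of_annihilator_le {R M : Type*} [CommRing R]
    [IsNoetherianRing R] [AddCommGroup M] [Module R M] [Module.Finite R M] {P : Ideal R}
    [P.IsPrime] (h : Module.annihilator R M ≤ P) :
    ∃ Q ∈ associatedPrimes R M, Module.annihilator R M ≤ Q ∧ Q ≤ P := by
  obtain ⟨Q, hQ, hQP⟩ := Ideal.exists_minimalPrimes_le h
  exact ⟨Q, Module.associatedPrimes.minimalPrimes_annihilator_subset_associatedPrimes R M hQ,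
    hQ.1.2, hQP⟩

/-- The cyclic module `R g` has annihilator inside `P`; a minimal prime over this annihilator below
`P` is associated and contains `x`. -/
theorem exists_associatedPrime_of_smul_eq_zero {R M : Type*} [CommRing R]
    [IsNoetherianRing R] [AddCommGroup M] [Module R M] {P : Ideal R} [P.IsPrime] {x : R} {g : M}
    (hx : x • g = 0) (hP : ∀ u : R, u • g = 0 → u ∈ P) :
    ∃ Q ∈ associatedPrimes R M, x ∈ Q ∧ Q ≤ P := by
  have hg : g ∈ Submodule.span R {g} := Submodule.mem_span_singleton_self g
  obtain ⟨Q, hQ, hle, hQP⟩ := exists_associatedPrime_le_of_annihilator_le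
    (M := Submodule.span R {g}) (P := P) fun u hu ↦ hP u <| by
      simpa using congrArg Subtype.val (Module.mem_annihilator.mp hu ⟨g, hg⟩)
  refine ⟨Q, associatedPrimes.subset_of_injective (Submodule.subtype_injective _) hQ,
    hle (Module.mem_annihilator.mpr ?_), hQP⟩
  rintro ⟨m, hm⟩
  obtain ⟨a, rfl⟩ := Submodule.mem_span_singleton.mp hm
  exact Subtype.ext (by simp [smul_comm x a, hx])

/-- Let `N` be the submodule of `M` killed by `Q`. Regularity of `x` makes `N/xN → M/xM` injective,
and `N/xN` is nonzero at `P` by Nakayama. An associated prime of `N/xN` below `P` contains both `Q`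
and `x`. -/
theorem exists_associatedPrime_quotSMulTop {R M : Type*} [CommRing R] [IsNoetherianRing R]
    [AddCommGroup M] [Module R M] [Module.Finite R M] {P Q : Ideal R} [P.IsPrime] {x : R}
    (hxP : x ∈ P) (hx : IsSMulRegular M x) (hQ : Q ∈ associatedPrimes R M) (hQP : Q ≤ P) :
    ∃ Q' ∈ associatedPrimes R (QuotSMulTop x M), Q ≤ Q' ∧ x ∈ Q' ∧ Q' ≤ P := by
  let N : Submodule R M :=
    { carrier := {m | ∀ q ∈ Q, q • m = 0}
      add_mem' := fun ha hb q hq ↦ by rw [smul_add, ha q hq, hb q hq, add_zero]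
      zero_mem' := fun q _ ↦ smul_zero q
      smul_mem' := fun c m hm q hq ↦ by rw [smul_comm, hm q hq, smul_zero] }
  have hNP : (⟨P, ‹_›⟩ : PrimeSpectrum R) ∈ Module.support R (QuotSMulTop x N) := by
    rw [Module.support_quotSMulTop]
    refine ⟨?_, by simpa using hxP⟩
    rw [Module.support_eq_zeroLocus]
    refine le_trans (fun u hu ↦ ?_) hQP
    obtain ⟨-, m, hm⟩ := isAssociatedPrime_iff.mp hQ
    have hmN : m ∈ N := fun q hq ↦ by
      rw [hm, Submodule.mem_colon_singleton] at hq
      simpa using hq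
    have := congrArg Subtype.val (Module.mem_annihilator.mp hu ⟨m, hmN⟩)
    rw [hm, Submodule.mem_colon_singleton]
    simpa using this
  rw [Module.support_eq_zeroLocus] at hNP
  obtain ⟨Q', hQ', hle, hQ'P⟩ := exists_associatedPrime_le_of_annihilator_le hNP
  have hinj : Function.Injective (QuotSMulTop.map x N.subtype) := by
    refine (injective_iff_map_eq_zero _).mpr fun y hy ↦ ?_
    obtain ⟨⟨y, hyN⟩, rfl⟩ := Submodule.mkQ_surjective _ y
    have hy : Submodule.mkQ (x • (⊤ : Submodule R M)) y = 0 := hy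
    rw [Submodule.mkQ_apply, Submodule.Quotient.mk_eq_zero] at hy
    obtain ⟨m, -, hm⟩ := (Submodule.mem_smul_pointwise_iff_exists _ _ _).mp hy
    have hmN : m ∈ N := fun q hq ↦ by
      have : x • q • m = x • (0 : M) := by rw [smul_comm, hm, hyN q hq, smul_zero]
      exact hx this
    rw [Submodule.mkQ_apply, Submodule.Quotient.mk_eq_zero]
    exact (Submodule.mem_smul_pointwise_iff_exists _ _ _).mpr ⟨⟨m, hmN⟩, trivial, Subtype.ext hm⟩
  refine ⟨Q', associatedPrimes.subset_of_injective hinj hQ', fun q hq ↦ hle ?_, hle ?_, hQ'P⟩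
  · refine Module.mem_annihilator.mpr fun y ↦ ?_
    obtain ⟨⟨y, hyN⟩, rfl⟩ := Submodule.mkQ_surjective _ y
    rw [← map_smul]
    have : q • (⟨y, hyN⟩ : N) = 0 := Subtype.ext (hyN q hq)
    rw [this, map_zero]
  · refine Module.mem_annihilator.mpr fun y ↦ ?_
    obtain ⟨y, rfl⟩ := Submodule.mkQ_surjective _ y
    rw [← map_smul, Submodule.mkQ_apply, Submodule.Quotient.mk_eq_zero]
    exact Submodule.smul_mem_pointwise_smul _ _ _ trivial

/-- A regular sequence of length `r` in `P` forces `dim (R/Q)_P ≥ r` for the associated primes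
`Q ≤ P`. -/
theorem height_map_add_length_le {R S : Type*} [CommRing R] [CommRing S] [IsNoetherianRing R]
    {φ : R →+* S} (hφ : Function.Surjective φ) {P : Ideal R} [P.IsPrime] (rs : List R)
    (mem : ∀ r ∈ rs, r ∈ P) {M : Type*} [AddCommGroup M] [Module R M] [Module.Finite R M]
    (reg : IsWeaklyRegular M rs) {Q : Ideal R} (hQ : Q ∈ associatedPrimes R M) (hQP : Q ≤ P)
    (hker : RingHom.ker φ ≤ Q) :
    (Q.map φ).height + rs.length ≤ (P.map φ).height := by
  -- `φ` stays fixed while `Q` climbs, one strict step for each element of the sequence. Taking `φ`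
  -- to be the quotient by the initial prime bounds the height of `P/Q`.
  induction rs generalizing M Q with
  | nil => simpa using Ideal.height_mono (Ideal.map_mono hQP)
  | cons x rs ih =>
    rw [isWeaklyRegular_cons_iff] at reg
    obtain ⟨Q', hQ', hle, hxQ', hQ'P⟩ :=
      exists_associatedPrime_quotSMulTop (mem x List.mem_cons_self) reg.1 hQ hQP
    have h1 := ih (fun r hr ↦ mem r (List.mem_cons_of_mem x hr)) reg.2 hQ' hQ'P (hker.trans hle)
    have hp : Q.IsPrime := IsAssociatedPrime.isPrime hQ
    have hp' : Q'.IsPrime := IsAssociatedPrime.isPrime hQ'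
    have := Ideal.map_isPrime_of_surjective hφ hker
    have := Ideal.map_isPrime_of_surjective hφ (hker.trans hle)
    -- An element with annihilator `Q` is nonzero, so the regular element `x` cannot kill it; hence
    -- the inclusion of `Q` in `Q'` is strict.
    have hxQ : x ∉ Q := by
      intro hxQ
      obtain ⟨-, m, hm⟩ := isAssociatedPrime_iff.mp hQ
      have h0 : m = 0 := reg.1 (by
        rw [hm, Submodule.mem_colon_singleton] at hxQ
        simpa using hxQ)
      exact hp.ne_top (by rw [hm, h0]; simp)
    have hlt : Q.map φ < Q'.map φ := by
      refine lt_of_le_of_ne (Ideal.map_mono hle) fun heq ↦ hxQ ?_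
      have h2 : φ x ∈ Q.map φ := heq ▸ Ideal.mem_map_of_mem φ hxQ'
      have h3 : x ∈ (Q.map φ).comap φ := h2
      rwa [Ideal.comap_map_of_surjective φ hφ, ← RingHom.ker_eq_comap_bot, sup_of_le_left hker]
        at h3
    have h4 := Ideal.height_add_one_le_of_lt_of_isPrime hlt
    rw [List.length_cons, Nat.cast_succ, add_comm (rs.length : ℕ∞), ← add_assoc]
    exact (add_le_add_left h4 _).trans h1

theorem length_le_height_of_isWeaklyRegular {R : Type*} [CommRing R] [IsNoetherianRing R]
    {P : Ideal R} [P.IsPrime] {rs : List R} (mem : ∀ r ∈ rs, r ∈ P)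
    (reg : IsWeaklyRegular R rs) : (rs.length : ℕ∞) ≤ P.height := by
  obtain ⟨Q, hQ, -, hQP⟩ := exists_associatedPrime_le_of_annihilator_le (M := R) (P := P) (by
    intro u hu
    have := Module.mem_annihilator.mp hu 1
    rw [smul_eq_mul, mul_one] at this
    rw [this]
    exact P.zero_mem)
  have := height_map_add_length_le (φ := RingHom.id R) Function.surjective_id rs mem reg hQ hQP
    (by simp [RingHom.ker_eq_comap_bot])
  rw [Ideal.map_id, Ideal.map_id] at this
  exact le_trans le_add_self this

/-- A chain of primes below `p` pulls back to a chain of primes that all contain `ker φ`. The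
induction runs over finite lower bounds of `p.height`, so that infinite height is covered. -/
theorem height_ker_add_height_le {R S : Type*} [CommRing R] [CommRing S]
    {φ : R →+* S} (hφ : Function.Surjective φ) (p : Ideal S) [hp : p.IsPrime] :
    (RingHom.ker φ).height + p.height ≤ (p.comap φ).height := by
  have key : ∀ (m : ℕ) (p : Ideal S), p.IsPrime → (m : ℕ∞) ≤ p.height →
      (RingHom.ker φ).height + m ≤ (p.comap φ).height := by
    intro m
    induction m with
    | zero =>
      intro p _ _
      rw [Nat.cast_zero, add_zero]
      exact Ideal.height_mono (Ideal.comap_mono bot_le)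
    | succ m ih =>
      intro p hp hm
      have h1 : ¬ p.height ≤ m := by
        intro h
        exact absurd (Nat.cast_le.mp (hm.trans h)) (by simp)
      rw [Ideal.height_le_iff] at h1
      push Not at h1
      obtain ⟨q, hq, hqp, hmq⟩ := h1
      have h2 := ih q hq hmq
      have hlt : q.comap φ < p.comap φ :=
        lt_of_le_of_ne (Ideal.comap_mono hqp.le)
          fun h ↦ hqp.ne (Ideal.comap_injective_of_surjective φ hφ h)
      have h3 := Ideal.height_add_one_le_of_lt_of_isPrime hlt
      rw [Nat.cast_succ, ← add_assoc]
      exact (add_le_add_left h2 1).trans h3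
  by_cases htop : p.height = ⊤
  · have h1 : (p.comap φ).height = ⊤ := by
      refine ENat.eq_top_iff_forall_ge.mpr fun m ↦ le_trans le_add_self (key m p hp ?_)
      rw [htop]; exact le_top
    rw [h1]; exact le_top
  · obtain ⟨m, hm⟩ := ENat.ne_top_iff_exists.mp htop
    rw [← hm]
    exact key m p hp hm.le

end AssociatedPrimes

/-! ### Regular sequences of length `N` in all maximal ideals of a polynomial ring in `N` variables.
-/

section Polynomial

open RingTheory.Sequence

/-- Every maximal ideal of `A` contains a weakly regular sequence of length `N`. -/
def HasRegularSequences (A : Type*) [CommRing A] (N : ℕ) : Prop :=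
  ∀ P : Ideal A, P.IsMaximal →
    ∃ rs : List A, rs.length = N ∧ (∀ r ∈ rs, r ∈ P) ∧ IsWeaklyRegular A rs

theorem HasRegularSequences.of_ringEquiv {A B : Type*} [CommRing A] [CommRing B] {N : ℕ}
    (e : A ≃+* B) (h : HasRegularSequences A N) : HasRegularSequences B N := by
  intro P hP
  have hP' : (P.comap (e : A →+* B)).IsMaximal :=
    Ideal.comap_isMaximal_of_surjective (e : A →+* B) e.surjective
  obtain ⟨rs, hlen, hmem, hreg⟩ := h _ hP'
  refine ⟨rs.map e, by simpa using hlen, by simpa using hmem, ?_⟩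
  refine (AddEquiv.isWeaklyRegular_congr (e := e.toAddEquiv) (as := rs) (bs := rs.map e) ?_).mp hreg
  refine List.forall₂_map_right_iff.mpr (List.forall₂_same.mpr fun r _ x ↦ ?_)
  simp

/-- In the Jacobson case `P` contracts to a maximal ideal `q`, and `P` is generated by `q` and a
monic polynomial. A regular sequence in `q` stays regular by flatness, and the monic polynomial is
regular modulo any extended ideal. -/
theorem HasRegularSequences.polynomial {A : Type*} [CommRing A] [IsJacobsonRing A] {N : ℕ}
    (h : HasRegularSequences A N) : HasRegularSequences (Polynomial A) (N + 1) := by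
  intro P hP
  have hq : (P.comap (Polynomial.C : A →+* Polynomial A)).IsMaximal :=
    Polynomial.isMaximal_comap_C_of_isJacobsonRing P
  -- `(A/q)[X]` is not a field: an inverse of `X` modulo the extension of `q` would put `1` in `q`,
  -- by comparing constant coefficients.
  have hne : P ≠ (P.comap Polynomial.C).map Polynomial.C := by
    intro heq
    have hX : Polynomial.X ∉ P := by
      intro hX
      rw [heq, Ideal.mem_map_C_iff] at hX
      exact hq.ne_top ((Ideal.eq_top_iff_one _).mpr (by simpa using hX 1))
    obtain ⟨y, i, hi, hy⟩ := hP.exists_inv hX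
    rw [heq, Ideal.mem_map_C_iff] at hi
    have h0 := hi 0
    have h1 : i.coeff 0 = 1 := by simpa using congrArg (fun p ↦ Polynomial.coeff p 0) hy
    rw [h1] at h0
    exact hq.ne_top ((Ideal.eq_top_iff_one _).mpr h0)
  obtain ⟨y, hmonic, hy⟩ := Polynomial.exists_monic_span_sup_map_eq A P hq hne
  have hyP : y ∈ P := by
    rw [hy]
    exact Ideal.mem_sup_right (Ideal.mem_span_singleton_self y)
  obtain ⟨rs, hlen, hmem, hreg⟩ := h _ hq
  refine ⟨rs.map (algebraMap A (Polynomial A)) ++ [y], by simp [hlen], ?_, ?_⟩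
  · intro r hr
    rcases List.mem_append.mp hr with hr | hr
    · obtain ⟨a, ha, rfl⟩ := List.mem_map.mp hr
      exact hmem a ha
    · rwa [List.mem_singleton.mp hr]
  · rw [isWeaklyRegular_append_iff, isWeaklyRegular_singleton_iff]
    refine ⟨hreg.of_flat, ?_⟩
    rw [isSMulRegular_quotient_iff_mem_of_smul_mem]
    intro g hg
    rw [smul_eq_mul, Ideal.mul_top, ← Ideal.map_ofList, Polynomial.algebraMap_eq] at hg ⊢
    rw [← Ideal.mk_ker (I := Ideal.ofList rs), ← Polynomial.ker_mapRingHom, RingHom.mem_ker] at hg ⊢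
    rw [smul_eq_mul, map_mul] at hg
    exact (Polynomial.Monic.mul_right_eq_zero_iff (hmonic.map _)).mp hg

theorem hasRegularSequences_mvPolynomial (k : Type*) [Field k] (N : ℕ) :
    HasRegularSequences (MvPolynomial (Fin N) k) N := by
  induction N with
  | zero => exact fun P _ ↦ ⟨[], rfl, by simp, IsWeaklyRegular.nil _ _⟩
  | succ N ih =>
    exact ih.polynomial.of_ringEquiv (MvPolynomial.finSuccEquiv k N).toRingEquiv.symm

end Polynomial

/-! ### Ideals of products in a regular family. -/

section ProductIdeal

/-- Every `f a`, `a ∈ T`, is a nonzerodivisor modulo `L + (f_i : i ∈ B)` for all `B ⊆ T` with at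
most `c` elements and `a ∉ B`. -/
def IsRegularFamily {R ι : Type*} [CommRing R] (f : ι → R) (T : Finset ι) (c : ℕ)
    (L : Ideal R) : Prop :=
  ∀ B ⊆ T, B.card ≤ c → ∀ a ∈ T, a ∉ B →
    ∀ g, f a * g ∈ L ⊔ Ideal.span (f '' (B : Set ι)) → g ∈ L ⊔ Ideal.span (f '' (B : Set ι))

/-- The ideal generated by the products of `|T| + 1 - c` of the elements `f i`, `i ∈ T`. -/
def productIdeal {R ι : Type*} [CommRing R] (f : ι → R) (T : Finset ι) (c : ℕ) : Ideal R :=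
  Ideal.span ((fun A : Finset ι ↦ ∏ i ∈ A, f i) '' {A | A ∈ T.powersetCard (T.card + 1 - c)})

variable {R ι : Type*} [CommRing R] {f : ι → R} {T : Finset ι} {c : ℕ} {L : Ideal R}

theorem IsRegularFamily.mono {T' : Finset ι} {c' : ℕ} (hT : T' ⊆ T) (hc : c' ≤ c)
    (h : IsRegularFamily f T c L) : IsRegularFamily f T' c' L :=
  fun B hB hBc a ha haB ↦ h B (hB.trans hT) (hBc.trans hc) a (hT ha) haB

/-- No subset of `T` has `|T| + 1` elements; this is the convention `V_{λ,0} = ℙⁿ`. -/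
theorem productIdeal_zero (f : ι → R) (T : Finset ι) : productIdeal f T 0 = ⊥ := by
  simp [productIdeal]

/-- The truncated subtraction gives `0` and the empty product is `1`; this is the empty scheme. -/
theorem productIdeal_of_card_lt (f : ι → R) (h : T.card < c) : productIdeal f T c = ⊤ := by
  have : T.card + 1 - c = 0 := by lia
  simp [productIdeal, this]

theorem prod_mem_span_image {A B : Finset ι} (h : ¬ Disjoint A B) :
    ∏ i ∈ A, f i ∈ Ideal.span (f '' (B : Set ι)) := by
  classical
  obtain ⟨i, hiA, hiB⟩ := Finset.not_disjoint_iff.mp h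
  exact Ideal.mem_of_dvd _ (Finset.dvd_prod_of_mem f hiA)
    (Ideal.subset_span ⟨i, hiB, rfl⟩)

/-- Pigeonhole: subsets of `T` with `|T| + 1 - c` and `c` elements meet. -/
theorem productIdeal_le_span_image {B : Finset ι} (hB : B ∈ T.powersetCard c) :
    productIdeal f T c ≤ Ideal.span (f '' (B : Set ι)) := by
  classical
  refine Ideal.span_le.mpr ?_
  rintro _ ⟨A, hA, rfl⟩
  rw [Finset.mem_powersetCard] at hB
  obtain ⟨hAT, hAc⟩ := Finset.mem_powersetCard.mp hA
  refine prod_mem_span_image fun hd ↦ ?_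
  have h1 := Finset.card_le_card (Finset.union_subset hAT hB.1)
  rw [Finset.card_union_of_disjoint hd, hAc, hB.2] at h1
  lia

theorem productIdeal_le_succ (f : ι → R) (T : Finset ι) (c : ℕ) :
    productIdeal f T c ≤ productIdeal f T (c + 1) := by
  refine Ideal.span_le.mpr ?_
  rintro _ ⟨A, hA, rfl⟩
  obtain ⟨hAT, hAc⟩ := Finset.mem_powersetCard.mp hA
  obtain ⟨A', hA', hcard⟩ := Finset.exists_subset_card_eq (s := A) (n := T.card + 1 - (c + 1))
    (by lia)
  exact Ideal.mem_of_dvd _ (Finset.prod_dvd_prod_of_subset _ _ f hA')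
    (Ideal.subset_span ⟨A', Finset.mem_powersetCard.mpr ⟨hA'.trans hAT, hcard⟩, rfl⟩)

/-- The basic double link: the products without `f a` generate the first summand, those with `f a`
the second. -/
theorem productIdeal_insert [DecidableEq ι] (f : ι → R) {a : ι} (ha : a ∉ T) (c : ℕ) :
    productIdeal f (insert a T) (c + 1) =
      productIdeal f T c ⊔ Ideal.span {f a} * productIdeal f T (c + 1) := by
  by_cases hc : T.card < c
  · rw [productIdeal_of_card_lt f hc, productIdeal_of_card_lt f, top_sup_eq]
    rw [Finset.card_insert_of_notMem ha]
    lia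
  obtain ⟨m, hm⟩ : ∃ m, T.card = c + m := ⟨T.card - c, by lia⟩
  have h1 : (insert a T).card + 1 - (c + 1) = m + 1 := by
    rw [Finset.card_insert_of_notMem ha]
    lia
  have h2 : T.card + 1 - c = m + 1 := by lia
  have h3 : T.card + 1 - (c + 1) = m := by lia
  rw [productIdeal, productIdeal, productIdeal, h1, h2, h3, Ideal.span_mul_span', ← Ideal.span_union]
  congr 1
  ext x
  simp only [Finset.powersetCard_succ_insert ha, Finset.mem_union, Finset.mem_image,
    Set.mem_image, Set.mem_ofPred_eq, Set.mem_union, Set.mem_mul, Set.mem_singleton_iff]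
  constructor
  · rintro ⟨A, hA | ⟨A, hA, rfl⟩, rfl⟩
    · exact Or.inl ⟨A, hA, rfl⟩
    · refine Or.inr ⟨f a, rfl, _, ⟨A, hA, rfl⟩, ?_⟩
      rw [Finset.prod_insert fun h ↦ ha ((Finset.mem_powersetCard.mp hA).1 h)]
  · rintro (⟨A, hA, rfl⟩ | ⟨_, rfl, _, ⟨A, hA, rfl⟩, rfl⟩)
    · exact ⟨A, Or.inl hA, rfl⟩
    · refine ⟨insert a A, Or.inr ⟨A, hA, rfl⟩, ?_⟩
      rw [Finset.prod_insert fun h ↦ ha ((Finset.mem_powersetCard.mp hA).1 h)]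

theorem sup_span_image_insert [DecidableEq ι] (f : ι → R) (L : Ideal R) (a : ι) (B : Finset ι) :
    L ⊔ Ideal.span (f '' (insert a B : Finset ι)) =
      L ⊔ Ideal.span {f a} ⊔ Ideal.span (f '' (B : Set ι)) := by
  rw [Finset.coe_insert, Set.image_insert_eq, Ideal.span_insert, sup_assoc]

theorem IsRegularFamily.insert_base [DecidableEq ι] {a : ι} (ha : a ∉ T)
    (h : IsRegularFamily f (insert a T) (c + 1) L) :
    IsRegularFamily f T c (L ⊔ Ideal.span {f a}) := by
  intro B hB hBc b hb hbB g hg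
  rw [← sup_span_image_insert] at hg ⊢
  refine h _ (Finset.insert_subset_insert a hB)
    ((Finset.card_insert_le a B).trans (by lia)) b (Finset.mem_insert_of_mem hb) ?_ g hg
  rw [Finset.mem_insert]
  rintro (rfl | h)
  exacts [ha hb, hbB h]

/-- Write `J`, `K` for the product ideals of `T` at `c`, `c + 1`. For `x` in the intersection, the
subsets without `a` give `x ∈ L + K`, and those with `a` give `x = j + g f_a` with `j ∈ L + J`. Then
`g f_a ∈ L + K`, and cancelling `f_a` modulo each complete intersection gives `g ∈ L + K`, so `x ∈ L
+ J + f_a K`. The base ideal `L` is there to absorb `f_a` in the second use of the induction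
hypothesis. -/
theorem sup_productIdeal_eq_iInf (h : IsRegularFamily f T c L) :
    L ⊔ productIdeal f T c = ⨅ A ∈ T.powersetCard c, L ⊔ Ideal.span (f '' (A : Set ι)) := by
  classical
  induction T using Finset.induction_on generalizing c L with
  | empty =>
    cases c with
    | zero => simp [productIdeal_zero]
    | succ c =>
      rw [productIdeal_of_card_lt f (by simp), Finset.powersetCard_eq_empty.mpr (by simp)]
      simp
  | insert a T ha ih =>
    cases c with
    | zero => simp [productIdeal_zero]
    | succ c =>
      refine le_antisymm
        (le_iInf₂ fun A hA ↦ sup_le_sup_left (productIdeal_le_span_image hA) L) fun x hx ↦ ?_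
      simp only [Ideal.mem_iInf] at hx
      have hK := ih (h.mono (Finset.subset_insert a T) le_rfl)
      have hJ := ih (h.insert_base ha)
      have hxK : x ∈ L ⊔ productIdeal f T (c + 1) := by
        rw [hK]
        simp only [Ideal.mem_iInf]
        exact fun A hA ↦ hx A (Finset.powersetCard_mono (Finset.subset_insert a T) hA)
      have hxJ : x ∈ L ⊔ Ideal.span {f a} ⊔ productIdeal f T c := by
        rw [hJ]
        simp only [Ideal.mem_iInf]
        intro B hB
        obtain ⟨hBT, hBc⟩ := Finset.mem_powersetCard.mp hB
        rw [← sup_span_image_insert]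
        refine hx _ (Finset.mem_powersetCard.mpr ⟨Finset.insert_subset_insert a hBT, ?_⟩)
        rw [Finset.card_insert_of_notMem fun h ↦ ha (hBT h), hBc]
      rw [sup_right_comm] at hxJ
      obtain ⟨j, hj, z, hz, rfl⟩ := Submodule.mem_sup.mp hxJ
      obtain ⟨g, rfl⟩ := Ideal.mem_span_singleton'.mp hz
      have hjK : j ∈ L ⊔ productIdeal f T (c + 1) :=
        sup_le_sup_left (productIdeal_le_succ f T c) L hj
      have hgK : g ∈ L ⊔ productIdeal f T (c + 1) := by
        have h1 := (Ideal.add_mem_iff_right _ hjK).mp hxK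
        rw [hK] at h1 ⊢
        simp only [Ideal.mem_iInf] at h1 ⊢
        intro A hA
        obtain ⟨hAT, hAc⟩ := Finset.mem_powersetCard.mp hA
        refine h A (hAT.trans (Finset.subset_insert a T)) hAc.le a (Finset.mem_insert_self a T)
          (fun h ↦ ha (hAT h)) g ?_
        rw [mul_comm]
        exact h1 A hA
      rw [productIdeal_insert f ha, ← sup_assoc]
      refine Ideal.add_mem _ (Ideal.mem_sup_left hj) ?_
      obtain ⟨l, hl, p, hp, rfl⟩ := Submodule.mem_sup.mp hgK
      have h1 : l * f a ∈ L := L.mul_mem_right (f a) hl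
      have h2 : f a * p ∈ Ideal.span {f a} * productIdeal f T (c + 1) :=
        Ideal.mul_mem_mul (Ideal.mem_span_singleton_self _) hp
      rw [add_mul, mul_comm p]
      exact Submodule.add_mem _ (Ideal.mem_sup_left (Ideal.mem_sup_left h1))
        (Ideal.mem_sup_right h2)

theorem productIdeal_eq_iInf (h : IsRegularFamily f T c ⊥) :
    productIdeal f T c = ⨅ A ∈ T.powersetCard c, Ideal.span (f '' (A : Set ι)) := by
  simpa using sup_productIdeal_eq_iInf h

theorem mem_productIdeal_of_mul_mem [DecidableEq ι] {a : ι} (ha : a ∉ T)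
    (h : IsRegularFamily f (insert a T) c ⊥) {g : R} (hg : f a * g ∈ productIdeal f T c) :
    g ∈ productIdeal f T c := by
  rw [productIdeal_eq_iInf (h.mono (Finset.subset_insert a T) le_rfl)] at hg ⊢
  simp only [Ideal.mem_iInf] at hg ⊢
  intro A hA
  obtain ⟨hAT, hAc⟩ := Finset.mem_powersetCard.mp hA
  have := h A (hAT.trans (Finset.subset_insert a T)) hAc.le a (Finset.mem_insert_self a T)
    (fun h ↦ ha (hAT h)) g
  rw [bot_sup_eq] at this
  exact this (hg A hA)

/-- In each link `J` has index one less than `K`, hence depth one more, exactly as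
`ExtVanishes.of_basicDoubleLink` requires. -/
theorem extVanishes_productIdeal {R : Type*} [CommRing R] {P : Ideal R} {f : ι → R} {T : Finset ι}
    {c r : ℕ} (h : IsRegularFamily f T c ⊥)
    (hP : ExtVanishes P (r + c) (ModuleCat.of R (R ⧸ (⊥ : Ideal R)))) :
    ExtVanishes P r (ModuleCat.of R (R ⧸ productIdeal f T c)) := by
  classical
  induction T using Finset.induction_on generalizing c r with
  | empty =>
    cases c with
    | zero => rwa [productIdeal_zero]
    | succ c =>
      rw [productIdeal_of_card_lt f (by simp)]
      have : Subsingleton (ModuleCat.of R (R ⧸ (⊤ : Ideal R))) :=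
        Ideal.Quotient.subsingleton_iff.mpr rfl
      exact extVanishes_of_subsingleton P r _
  | insert a T ha ih =>
    cases c with
    | zero => rwa [productIdeal_zero]
    | succ c =>
      rw [productIdeal_insert f ha]
      refine ExtVanishes.of_basicDoubleLink (productIdeal_le_succ f T c)
        (fun g hg ↦ mem_productIdeal_of_mul_mem ha (h.mono subset_rfl (Nat.le_succ c)) hg)
        (ih (h.mono (Finset.subset_insert a T) (Nat.le_succ c)) (hP.mono (by lia)))
        (ih (h.mono (Finset.subset_insert a T) le_rfl) hP)

theorem prod_notMem_span_image {A B : Finset ι} (hA : A ⊆ T) (hB : B ⊆ T) (hBc : B.card ≤ c)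
    (hAB : Disjoint A B) (h : IsRegularFamily f T c ⊥) (hne : Ideal.span (f '' (B : Set ι)) ≠ ⊤) :
    ∏ i ∈ A, f i ∉ Ideal.span (f '' (B : Set ι)) := by
  classical
  induction A using Finset.induction_on with
  | empty => rwa [Finset.prod_empty, ← Ideal.eq_top_iff_one]
  | insert a A ha ih =>
    rw [Finset.disjoint_insert_left] at hAB
    intro hmem
    rw [Finset.prod_insert ha] at hmem
    have := h B hB hBc a (hA (Finset.mem_insert_self a A)) hAB.1
    rw [bot_sup_eq] at this
    exact ih ((Finset.subset_insert a A).trans hA) hAB.2 (this _ hmem)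

/-- No product is contained in the ideal generated by the other products of the same length. -/
theorem prod_notMem_span_prod [DecidableEq ι] {A : Finset ι} {m : ℕ} (hA : A ∈ T.powersetCard m)
    (hm : T.card ≤ m + c) (h : IsRegularFamily f T c ⊥)
    (hne : Ideal.span (f '' (T : Set ι)) ≠ ⊤) :
    ∏ i ∈ A, f i ∉ Ideal.span ((fun B : Finset ι ↦ ∏ i ∈ B, f i) ''
      {B | B ∈ T.powersetCard m ∧ B ≠ A}) := by
  obtain ⟨hAT, hAc⟩ := Finset.mem_powersetCard.mp hA
  intro hmem
  -- The ideal of the complement of `A` separates: any other subset of the same size meets `T \ A`,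
  -- whereas the factors indexed by `A` are regular modulo it.
  refine prod_notMem_span_image (B := T \ A) hAT Finset.sdiff_subset ?_ Finset.disjoint_sdiff h ?_
    (Ideal.span_le.mpr ?_ hmem)
  · rw [Finset.card_sdiff_of_subset hAT]
    lia
  · refine fun htop ↦ hne (top_le_iff.mp (htop ▸ Ideal.span_mono (Set.image_mono ?_)))
    exact Finset.coe_subset.mpr Finset.sdiff_subset
  · rintro _ ⟨B, ⟨hB, hBA⟩, rfl⟩
    obtain ⟨hBT, hBc⟩ := Finset.mem_powersetCard.mp hB
    refine prod_mem_span_image fun hd ↦ hBA ?_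
    refine Finset.eq_of_subset_of_card_le (fun i hi ↦ ?_) (by lia)
    by_contra hiA
    exact Finset.disjoint_left.mp hd hi (Finset.mem_sdiff.mpr ⟨hBT hi, hiA⟩)

end ProductIdeal

/-! ### From the codimension hypothesis to regularity. -/

section Height

open RingTheory.Sequence

variable {k : Type*} [Field k] {n : ℕ}

attribute [local instance] MvPolynomial.gradedAlgebra

theorem mem_irrelevantIdeal_iff {p : MvPolynomial (Fin (n + 1)) k} :
    p ∈ irrelevantIdeal k n ↔ constantCoeff p = 0 := by
  have h := mem_pow_idealOfVars_iff' (σ := Fin (n + 1)) (R := k) 1 p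
  rw [pow_one] at h
  refine h.trans ⟨fun h ↦ h 0 (by simp), fun h x hx ↦ ?_⟩
  have : x = 0 := by
    rw [← Finsupp.degree_eq_zero_iff]
    lia
  rw [this]
  exact h

theorem irrelevantIdeal_isMaximal : (irrelevantIdeal k n).IsMaximal := by
  have : irrelevantIdeal k n =
      RingHom.ker (constantCoeff : MvPolynomial (Fin (n + 1)) k →+* k) := by
    ext p
    rw [mem_irrelevantIdeal_iff, RingHom.mem_ker]
  rw [this]
  exact RingHom.ker_isMaximal_of_surjective _ fun x ↦ ⟨C x, by simp⟩

theorem mem_irrelevantIdeal_of_isHomogeneous {p : MvPolynomial (Fin (n + 1)) k} {d : ℕ}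
    (hp : p.IsHomogeneous d) (hd : 1 ≤ d) : p ∈ irrelevantIdeal k n := by
  rw [mem_irrelevantIdeal_iff, constantCoeff_eq]
  exact hp.coeff_eq_zero (by simp; lia)

/-- A homogeneous ideal is determined by its localization at the irrelevant ideal. -/
theorem mem_of_mul_mem_of_notMem_irrelevantIdeal {I : Ideal (MvPolynomial (Fin (n + 1)) k)}
    (hI : I.IsHomogeneous (homogeneousSubmodule (Fin (n + 1)) k))
    {u g : MvPolynomial (Fin (n + 1)) k} (hu : u ∉ irrelevantIdeal k n) (hug : u * g ∈ I) :
    g ∈ I := by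
  rw [mem_irrelevantIdeal_iff] at hu
  -- `u` is a nonzero constant modulo the irrelevant ideal, so each use of `u * g ∈ I` gains one
  -- power of that ideal. The component of degree `j` is then read off modulo the power `j + 1`.
  have key : ∀ j, g ∈ I ⊔ irrelevantIdeal k n ^ j := by
    intro j
    induction j with
    | zero => simp
    | succ j ih =>
      have h1 : u - C (constantCoeff u) ∈ irrelevantIdeal k n := by
        rw [mem_irrelevantIdeal_iff]
        simp
      have h2 : (u - C (constantCoeff u)) * g ∈ I ⊔ irrelevantIdeal k n ^ (j + 1) := by
        obtain ⟨i, hi, p, hp, rfl⟩ := Submodule.mem_sup.mp ih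
        rw [mul_add, pow_succ']
        exact Ideal.add_mem _ (Ideal.mem_sup_left (I.mul_mem_left _ hi))
          (Ideal.mem_sup_right (Ideal.mul_mem_mul h1 hp))
      have h3 : C (constantCoeff u) * g ∈ I ⊔ irrelevantIdeal k n ^ (j + 1) := by
        have := Ideal.sub_mem _ (Ideal.mem_sup_left hug) h2
        rwa [← sub_mul, sub_sub_cancel] at this
      have h4 := Ideal.mul_mem_left _ (C (constantCoeff u)⁻¹) h3
      rwa [← mul_assoc, ← C_mul, inv_mul_cancel₀ hu, C_1, one_mul] at h4
  rw [mem_iff_homogeneousComponent_mem hI]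
  intro j
  obtain ⟨i, hi, p, hp, rfl⟩ := Submodule.mem_sup.mp (key (j + 1))
  have hp0 : homogeneousComponent j p = 0 := by
    refine homogeneousComponent_eq_zero' _ _ fun d hd ↦ ?_
    have := (mem_pow_idealOfVars_iff (j + 1) p).mp hp d hd
    lia
  rw [map_add, hp0, add_zero]
  exact homogeneousComponent_mem_of_mem hI hi j

theorem height_le_of_isPrime (Q : Ideal (MvPolynomial (Fin (n + 1)) k)) [Q.IsPrime] :
    Q.height ≤ (n + 1 : ℕ) := by
  have h := Ideal.height_le_ringKrullDim_of_isPrime (I := Q)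
  rw [MvPolynomial.ringKrullDim_of_isNoetherianRing, ringKrullDim_eq_zero_of_field, zero_add,
    Nat.card_fin] at h
  exact_mod_cast h

/-- Needed at every maximal ideal, homogeneous or not, because the Cohen-Macaulay property is tested
at all of them. -/
theorem extVanishes_of_isMaximal {P : Ideal (MvPolynomial (Fin (n + 1)) k)} (hP : P.IsMaximal) :
    ExtVanishes P (n + 1) (ModuleCat.of _ (MvPolynomial (Fin (n + 1)) k ⧸
      (⊥ : Ideal (MvPolynomial (Fin (n + 1)) k)))) := by
  obtain ⟨rs, hlen, hmem, hreg⟩ := hasRegularSequences_mvPolynomial k (n + 1) P hP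
  exact (extVanishes_of_isWeaklyRegular hP.ne_top hmem hreg).quotient_bot.mono hlen.ge

theorem span_image_isHomogeneous {ι : Type*} {f : ι → MvPolynomial (Fin (n + 1)) k} {d : ι → ℕ}
    {A : Finset ι} (hf : ∀ i ∈ A, (f i).IsHomogeneous (d i)) :
    (Ideal.span (f '' (A : Set ι))).IsHomogeneous (homogeneousSubmodule (Fin (n + 1)) k) := by
  refine Ideal.homogeneous_span _ _ ?_
  rintro _ ⟨i, hi, rfl⟩
  exact ⟨d i, hf i hi⟩

theorem span_image_le_irrelevantIdeal {ι : Type*} {f : ι → MvPolynomial (Fin (n + 1)) k}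
    {A : Finset ι} (hf : ∀ i ∈ A, f i ∈ irrelevantIdeal k n) :
    Ideal.span (f '' (A : Set ι)) ≤ irrelevantIdeal k n := by
  refine Ideal.span_le.mpr ?_
  rintro _ ⟨i, hi, rfl⟩
  exact hf i hi

/-- By Krull, passing from `R/Q` to its quotient by `C` lowers the height of `P` by at most `|C|`.
The kernel of `R → R/(Q + (C))` contains `I`, so the height left over plus that of `I` is at most
`N`. -/
theorem height_add_height_map_le {R : Type*} [CommRing R] [IsNoetherianRing R] {N : ℕ∞}
    (hN : ∀ (p : Ideal R) [p.IsPrime], p.height ≤ N) {I P Q : Ideal R} [P.IsPrime] (hQP : Q ≤ P)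
    {C : Set R} (hC : C ⊆ P) (hI : I ≤ Q ⊔ Ideal.span C) :
    I.height + (P.map (Ideal.Quotient.mk Q)).height ≤ N + C.encard := by
  have hp₁ : (P.map (Ideal.Quotient.mk Q)).IsPrime :=
    Ideal.map_isPrime_of_surjective Ideal.Quotient.mk_surjective (Ideal.mk_ker.le.trans hQP)
  have hs : Ideal.Quotient.mk Q '' C ⊆ P.map (Ideal.Quotient.mk Q) := by
    rintro _ ⟨x, hx, rfl⟩
    exact Ideal.mem_map_of_mem _ (hC hx)
  have h2 := Ideal.height_le_height_add_encard_of_subset _ hs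
  revert hs h2
  generalize hsdef : Ideal.Quotient.mk Q '' C = s
  intro hs h2
  have hp₂ : ((P.map (Ideal.Quotient.mk Q)).map (Ideal.Quotient.mk (Ideal.span s))).IsPrime :=
    Ideal.map_isPrime_of_surjective Ideal.Quotient.mk_surjective
      (Ideal.mk_ker.le.trans (Ideal.span_le.mpr hs))
  revert hp₂ h2
  generalize (P.map (Ideal.Quotient.mk Q)).map (Ideal.Quotient.mk (Ideal.span s)) = p₂
  intro h2 hp₂
  have h3 := height_ker_add_height_le
    (φ := (Ideal.Quotient.mk (Ideal.span s)).comp (Ideal.Quotient.mk Q))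
    (Ideal.Quotient.mk_surjective.comp Ideal.Quotient.mk_surjective) p₂
  have h5 : I ≤ RingHom.ker ((Ideal.Quotient.mk (Ideal.span s)).comp (Ideal.Quotient.mk Q)) := by
    refine hI.trans (sup_le (fun x hx ↦ ?_) (Ideal.span_le.mpr fun x hx ↦ ?_))
    · rw [RingHom.mem_ker, RingHom.comp_apply, Ideal.Quotient.eq_zero_iff_mem.mpr hx, map_zero]
    · refine (RingHom.mem_ker).mpr (Ideal.Quotient.eq_zero_iff_mem.mpr (Ideal.subset_span ?_))
      rw [← hsdef]
      exact ⟨x, hx, rfl⟩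
  have h6 : I.height + p₂.height ≤ N :=
    (add_le_add_left (Ideal.height_mono h5) _).trans (h3.trans (hN _))
  have h7 : s.encard ≤ C.encard := hsdef ▸ Set.encard_image_le _ _
  calc I.height + (P.map (Ideal.Quotient.mk Q)).height
      ≤ I.height + (p₂.height + C.encard) := by gcongr; exact h2.trans (by gcongr)
    _ ≤ N + C.encard := by rw [← add_assoc]; gcongr

/-- If `|A|` elements of the irrelevant ideal `𝔪` generate an ideal of height `|A|`, then each of
them avoids the associated primes in `𝔪` of the ideal of some of the others. -/
theorem notMem_associatedPrime_of_height_eq {ι : Type*} [DecidableEq ι]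
    {f : ι → MvPolynomial (Fin (n + 1)) k} {A B : Finset ι} {a : ι} {r : ℕ}
    (hf : ∀ i ∈ A, f i ∈ irrelevantIdeal k n)
    (hA : (A.card : ℕ∞) ≤ (Ideal.span (f '' (A : Set ι))).height)
    (hB : insert a B ⊆ A) (ha : a ∉ B) (hr : r + B.card = n + 1)
    (hE : ExtVanishes (irrelevantIdeal k n) r
      (ModuleCat.of _ (MvPolynomial (Fin (n + 1)) k ⧸ Ideal.span (f '' (B : Set ι)))))
    {Q : Ideal (MvPolynomial (Fin (n + 1)) k)}
    (hQ : Q ∈ associatedPrimes (MvPolynomial (Fin (n + 1)) k)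
      (MvPolynomial (Fin (n + 1)) k ⧸ Ideal.span (f '' (B : Set ι))))
    (hQm : Q ≤ irrelevantIdeal k n) : f a ∉ Q := by
  intro haQ
  have hmax := irrelevantIdeal_isMaximal (k := k) (n := n)
  have hmp := hmax.isPrime
  have hQp : Q.IsPrime := IsAssociatedPrime.isPrime hQ
  obtain ⟨rs, hlen, hmem, hreg⟩ := hE.exists_isRegular hmax.ne_top
    (span_image_le_irrelevantIdeal fun i hi ↦ hf i (hB (Finset.mem_insert_of_mem hi)))
  have hBQ : Ideal.span (f '' (B : Set ι)) ≤ Q := by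
    have := IsAssociatedPrime.annihilator_le hQ
    rwa [Submodule.annihilator_top, Ideal.annihilator_quotient] at this
  have h1 := height_map_add_length_le (φ := Ideal.Quotient.mk Q) Ideal.Quotient.mk_surjective
    rs hmem hreg.toIsWeaklyRegular hQ hQm Ideal.mk_ker.le
  -- By `h1`, `P/Q` has height at least `r = n + 1 - |B|` for `P` the irrelevant ideal. If `f a ∈
  -- Q`, only the `|A| - |B| - 1` remaining forms are needed besides `Q`, and `|A| + r ≤ n + 1 + |A|
  -- - |B| - 1` is absurd.
  have h2 := height_add_height_map_le (N := (n + 1 : ℕ)) (fun p _ ↦ height_le_of_isPrime p) hQm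
    (C := f '' ((A \ insert a B : Finset ι) : Set ι)) (I := Ideal.span (f '' (A : Set ι))) ?_ ?_
  · have h3 : (f '' ((A \ insert a B : Finset ι) : Set ι)).encard ≤ (A \ insert a B).card :=
      (Set.encard_image_le _ _).trans (Set.encard_coe_eq_coe_finsetCard _).le
    have h4 : (A.card : ℕ∞) + r ≤ (n + 1 : ℕ) + (A \ insert a B).card := by
      rw [← hlen]
      exact (add_le_add hA (le_trans le_add_self h1)).trans (h2.trans (add_le_add_right h3 _))
    have h5 : A.card + r ≤ n + 1 + (A \ insert a B).card := by exact_mod_cast h4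
    have h6 := Finset.card_sdiff_add_card_eq_card hB
    rw [Finset.card_insert_of_notMem ha] at h6
    lia
  · rintro _ ⟨i, hi, rfl⟩
    exact hf i (Finset.mem_sdiff.mp hi).1
  · refine Ideal.span_le.mpr ?_
    rintro _ ⟨i, hi, rfl⟩
    by_cases hiB : i ∈ insert a B
    · refine Ideal.mem_sup_left ?_
      rcases Finset.mem_insert.mp hiB with rfl | hiB
      · exact haQ
      · exact hBQ (Ideal.subset_span ⟨i, hiB, rfl⟩)
    · exact Ideal.mem_sup_right
        (Ideal.subset_span ⟨i, Finset.mem_sdiff.mpr ⟨hi, hiB⟩, rfl⟩)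

/-- If `g` is not in the ideal, homogeneity forces its annihilator modulo the ideal into the
irrelevant ideal. So `f a` would lie in an associated prime inside the irrelevant ideal. -/
theorem mem_span_image_of_mul_mem {ι : Type*} [DecidableEq ι]
    {f : ι → MvPolynomial (Fin (n + 1)) k} {d : ι → ℕ} {A B : Finset ι} {a : ι} {r : ℕ}
    (hf : ∀ i ∈ A, (f i).IsHomogeneous (d i)) (hd : ∀ i ∈ A, 1 ≤ d i)
    (hA : (A.card : ℕ∞) ≤ (Ideal.span (f '' (A : Set ι))).height)
    (hB : insert a B ⊆ A) (ha : a ∉ B) (hr : r + B.card = n + 1)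
    (hE : ExtVanishes (irrelevantIdeal k n) r
      (ModuleCat.of _ (MvPolynomial (Fin (n + 1)) k ⧸ Ideal.span (f '' (B : Set ι)))))
    {g : MvPolynomial (Fin (n + 1)) k} (hg : f a * g ∈ Ideal.span (f '' (B : Set ι))) :
    g ∈ Ideal.span (f '' (B : Set ι)) := by
  have hmp := (irrelevantIdeal_isMaximal (k := k) (n := n)).isPrime
  have hfm : ∀ i ∈ A, f i ∈ irrelevantIdeal k n := fun i hi ↦
    mem_irrelevantIdeal_of_isHomogeneous (hf i hi) (hd i hi)
  by_contra hgI
  obtain ⟨Q, hQ, haQ, hQm⟩ := exists_associatedPrime_of_smul_eq_zero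
    (M := MvPolynomial (Fin (n + 1)) k ⧸ Ideal.span (f '' (B : Set ι)))
    (P := irrelevantIdeal k n) (x := f a) (g := Submodule.mkQ _ g) (by
      rw [← map_smul, Submodule.mkQ_apply, Submodule.Quotient.mk_eq_zero]
      exact hg) fun u hu ↦ by
      rw [← map_smul, Submodule.mkQ_apply, Submodule.Quotient.mk_eq_zero] at hu
      by_contra hum
      exact hgI (mem_of_mul_mem_of_notMem_irrelevantIdeal (span_image_isHomogeneous
        fun i hi ↦ hf i (hB (Finset.mem_insert_of_mem hi))) hum hu)
  exact notMem_associatedPrime_of_height_eq hfm hA hB ha hr hE hQ hQm haQ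

theorem extVanishes_span_image {ι : Type*}
    {f : ι → MvPolynomial (Fin (n + 1)) k} {d : ι → ℕ} {A B : Finset ι} {r : ℕ}
    (hf : ∀ i ∈ A, (f i).IsHomogeneous (d i)) (hd : ∀ i ∈ A, 1 ≤ d i)
    (hA : (A.card : ℕ∞) ≤ (Ideal.span (f '' (A : Set ι))).height)
    (hB : B ⊆ A) (hr : r + B.card = n + 1) :
    ExtVanishes (irrelevantIdeal k n) r
      (ModuleCat.of _ (MvPolynomial (Fin (n + 1)) k ⧸ Ideal.span (f '' (B : Set ι)))) := by
  classical
  induction B using Finset.induction_on generalizing r with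
  | empty =>
    rw [Finset.card_empty, add_zero] at hr
    rw [hr, Finset.coe_empty, Set.image_empty, Ideal.span_empty]
    exact extVanishes_of_isMaximal irrelevantIdeal_isMaximal
  | insert a B ha ih =>
    rw [Finset.card_insert_of_notMem ha] at hr
    have hE := ih ((Finset.subset_insert a B).trans hB) (r := r + 1) (by lia)
    -- A hypersurface section is the basic double link with `K = ⊤`, so the depth drops by one.
    have : Ideal.span (f '' (insert a B : Finset ι)) =
        Ideal.span (f '' (B : Set ι)) ⊔ Ideal.span {f a} * ⊤ := by
      rw [Ideal.mul_top, Finset.coe_insert, Set.image_insert_eq, Ideal.span_insert, sup_comm]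
    rw [this]
    have : Subsingleton (ModuleCat.of (MvPolynomial (Fin (n + 1)) k)
        (MvPolynomial (Fin (n + 1)) k ⧸ (⊤ : Ideal (MvPolynomial (Fin (n + 1)) k)))) :=
      Ideal.Quotient.subsingleton_iff.mpr rfl
    exact ExtVanishes.of_basicDoubleLink le_top
      (fun g hg ↦ mem_span_image_of_mul_mem hf hd hA hB ha (by lia) hE hg) hE
      (extVanishes_of_subsingleton _ r _)

/-- `B ∪ {a}` has at most `min (c + 1) |T|` elements and extends to a set `A` of exactly that size,
to which the height hypothesis applies. -/
theorem isRegularFamily_of_height_eq {ι : Type*}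
    {f : ι → MvPolynomial (Fin (n + 1)) k} {d : ι → ℕ} {T : Finset ι} {c : ℕ} (hcn : c ≤ n)
    (hf : ∀ i ∈ T, (f i).IsHomogeneous (d i)) (hd : ∀ i ∈ T, 1 ≤ d i)
    (hT : ∀ A ⊆ T, A.card = min (c + 1) T.card →
      (Ideal.span (f '' (A : Set ι))).height = A.card) :
    IsRegularFamily f T c ⊥ := by
  classical
  intro B hB hBc a ha haB g hg
  rw [bot_sup_eq] at hg ⊢
  have haBT := Finset.insert_subset ha hB
  have h1 := Finset.card_le_card haBT
  rw [Finset.card_insert_of_notMem haB] at h1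
  obtain ⟨A, hBA, hAT, hAc⟩ := Finset.exists_subsuperset_card_eq (n := min (c + 1) T.card) haBT
    (by rw [Finset.card_insert_of_notMem haB]; lia) (by lia)
  have hA := (hT A hAT hAc).ge
  exact mem_span_image_of_mul_mem (fun i hi ↦ hf i (hAT hi)) (fun i hi ↦ hd i (hAT hi)) hA hBA
    haB (r := n + 1 - B.card) (by lia)
    (extVanishes_span_image (fun i hi ↦ hf i (hAT hi)) (fun i hi ↦ hd i (hAT hi)) hA
      ((Finset.subset_insert a B).trans hBA) (by lia)) hg

end Height

/-! ### Complete intersections and their saturation. -/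

section Saturation

open RingTheory.Sequence

variable {k : Type*} [Field k] {n : ℕ}

/-- Positive depth gives an `x` in the irrelevant ideal that is regular modulo `I`; if a power of
that ideal multiplies `g` into `I`, then `x ^ m * g ∈ I` and `x ^ m` cancels. -/
theorem saturation_eq_self {I : Ideal (MvPolynomial (Fin (n + 1)) k)}
    (hI : I ≤ irrelevantIdeal k n)
    (hE : ExtVanishes (irrelevantIdeal k n) 1
      (ModuleCat.of _ (MvPolynomial (Fin (n + 1)) k ⧸ I))) :
    saturation I = I := by
  obtain ⟨rs, hlen, hmem, hreg⟩ :=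
    hE.exists_isRegular irrelevantIdeal_isMaximal.ne_top hI
  obtain ⟨x, rfl⟩ := List.length_eq_one_iff.mp hlen
  have hx := (isWeaklyRegular_singleton_iff _ _).mp hreg.toIsWeaklyRegular
  refine le_antisymm (iSup_le fun m g hg ↦ ?_) (le_iSup_of_le 0 fun g hg ↦ ?_)
  · have h1 := Submodule.mem_colon.mp hg (x ^ m)
      (Ideal.pow_mem_pow (hmem x (List.mem_singleton_self x)) m)
    refine mem_of_isSMulRegular_quotient_of_smul_mem (hx.pow m) ?_
    rwa [smul_eq_mul, mul_comm, ← smul_eq_mul]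
  · exact Submodule.mem_colon.mpr fun p _ ↦ I.mul_mem_right p hg

theorem span_image_eq_productIdeal {R ι : Type*} [CommRing R] {f : ι → R} {A : Finset ι}
    (h : IsRegularFamily f A A.card ⊥) :
    Ideal.span (f '' (A : Set ι)) = productIdeal f A A.card := by
  rw [productIdeal_eq_iInf h, Finset.powersetCard_self]
  simp

/-- Since `c ≤ n`, each complete intersection has depth at least `n + 1 - c ≥ 1`, so no saturation
is needed. -/
theorem configIdeal_eq_productIdeal {f : ℕ → MvPolynomial (Fin (n + 1)) k} {s c : ℕ}
    (hcn : c ≤ n) (hf : ∀ i ∈ Finset.Icc 1 s, f i ∈ irrelevantIdeal k n)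
    (h : IsRegularFamily f (Finset.Icc 1 s) c ⊥) :
    configIdeal f s c = productIdeal f (Finset.Icc 1 s) c := by
  rw [productIdeal_eq_iInf h]
  refine iInf_congr fun A ↦ iInf_congr fun hA ↦ ?_
  obtain ⟨hAs, rfl⟩ := Finset.mem_powersetCard.mp hA
  refine saturation_eq_self (span_image_le_irrelevantIdeal fun i hi ↦ hf i (hAs hi)) ?_
  have hA := h.mono hAs le_rfl
  rw [intersectionIdeal, span_image_eq_productIdeal hA]
  exact extVanishes_productIdeal hA
    ((extVanishes_of_isMaximal irrelevantIdeal_isMaximal).mono (by lia))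

end Saturation

/-! ### Hilbert functions of basic double links. -/

section HilbertFunction

variable {k : Type*} [Field k] {n : ℕ}

/-- The forms of degree `t` in `I`. -/
noncomputable def gradedPiece (I : Ideal (MvPolynomial (Fin (n + 1)) k)) (t : ℕ) :
    Submodule k (MvPolynomial (Fin (n + 1)) k) :=
  homogeneousSubmodule (Fin (n + 1)) k t ⊓ I.restrictScalars k

theorem mem_gradedPiece {I : Ideal (MvPolynomial (Fin (n + 1)) k)} {t : ℕ}
    {p : MvPolynomial (Fin (n + 1)) k} :
    p ∈ gradedPiece I t ↔ p.IsHomogeneous t ∧ p ∈ I := by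
  rw [gradedPiece, Submodule.mem_inf, mem_homogeneousSubmodule, Submodule.restrictScalars_mem]

instance finite_homogeneousSubmodule (t : ℕ) :
    FiniteDimensional k (homogeneousSubmodule (Fin (n + 1)) k t) :=
  Module.Finite.iff_fg.mpr (homogeneousSubmodule_fg (Fin (n + 1)) k t)

instance finite_gradedPiece (I : Ideal (MvPolynomial (Fin (n + 1)) k)) (t : ℕ) :
    FiniteDimensional k (gradedPiece I t) :=
  Submodule.finiteDimensional_of_le (inf_le_left : _ ≤ homogeneousSubmodule (Fin (n + 1)) k t)

theorem hilbertFunction_natCast (I : Ideal (MvPolynomial (Fin (n + 1)) k)) (t : ℕ) :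
    hilbertFunction I t = Module.finrank k (homogeneousSubmodule (Fin (n + 1)) k t) -
      Module.finrank k (gradedPiece I t) := by
  rw [hilbertFunction, if_neg (by simp), Int.toNat_natCast]
  have h := LinearMap.finrank_range_add_finrank_ker
    ((Ideal.Quotient.mkₐ k I).toLinearMap.domRestrict (homogeneousSubmodule (Fin (n + 1)) k t))
  have h2 : Module.finrank k (LinearMap.ker ((Ideal.Quotient.mkₐ k I).toLinearMap.domRestrict
      (homogeneousSubmodule (Fin (n + 1)) k t))) = Module.finrank k (gradedPiece I t) := by
    have h3 : (LinearMap.ker ((Ideal.Quotient.mkₐ k I).toLinearMap.domRestrict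
        (homogeneousSubmodule (Fin (n + 1)) k t))).map
          (homogeneousSubmodule (Fin (n + 1)) k t).subtype = gradedPiece I t := by
      ext p
      rw [mem_gradedPiece]
      constructor
      · rintro ⟨⟨p, hp⟩, hpI, rfl⟩
        exact ⟨hp, Ideal.Quotient.eq_zero_iff_mem.mp hpI⟩
      · rintro ⟨hp, hpI⟩
        exact ⟨⟨p, hp⟩, Ideal.Quotient.eq_zero_iff_mem.mpr hpI, rfl⟩
    rw [← h3]
    exact (Submodule.equivMapOfInjective _ (Submodule.subtype_injective _) _).finrank_eq
  rw [LinearMap.range_domRestrict, h2] at h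
  rw [← h]
  push_cast
  ring

theorem hilbertFunction_of_neg (I : Ideal (MvPolynomial (Fin (n + 1)) k)) {t : ℤ} (ht : t < 0) :
    hilbertFunction I t = 0 := if_pos ht

theorem homogeneousComponent_mul_of_isHomogeneous {f : MvPolynomial (Fin (n + 1)) k} {d : ℕ}
    (hf : f.IsHomogeneous d) (g : MvPolynomial (Fin (n + 1)) k) (t : ℕ) :
    homogeneousComponent t (f * g) =
      if d ≤ t then f * homogeneousComponent (t - d) g else 0 := by
  conv_lhs => rw [← sum_homogeneousComponent g]
  rw [Finset.mul_sum, map_sum]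
  have h1 : ∀ i, homogeneousComponent t (f * homogeneousComponent i g) =
      if t = d + i then f * homogeneousComponent i g else 0 := fun i ↦
    homogeneousComponent_of_mem (hf.mul (homogeneousComponent_isHomogeneous i g))
  simp_rw [h1]
  split_ifs with h
  · rw [Finset.sum_eq_single (t - d)]
    · rw [if_pos (by lia)]
    · intro i _ hi
      rw [if_neg (by lia)]
    · intro hi
      rw [Finset.mem_range] at hi
      rw [homogeneousComponent_eq_zero (t - d) g (by lia), mul_zero, ite_self]
  · exact Finset.sum_eq_zero fun i _ ↦ if_neg (by lia)

attribute [local instance] MvPolynomial.gradedAlgebra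

/-- `I_{t+d} = J_{t+d} + f K_t`, and the two summands meet in `f J_t` because `f` is regular modulo
`J`. -/
theorem finrank_gradedPiece_basicDoubleLink {J K : Ideal (MvPolynomial (Fin (n + 1)) k)}
    {f : MvPolynomial (Fin (n + 1)) k} {d : ℕ} (hf : f.IsHomogeneous d) (hf0 : f ≠ 0)
    (hJ : J.IsHomogeneous (homogeneousSubmodule (Fin (n + 1)) k))
    (hK : K.IsHomogeneous (homogeneousSubmodule (Fin (n + 1)) k)) (hJK : J ≤ K)
    (hreg : ∀ g, f * g ∈ J → g ∈ J) (t : ℕ) :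
    Module.finrank k (gradedPiece (J ⊔ Ideal.span {f} * K) (t + d)) +
      Module.finrank k (gradedPiece J t) =
    Module.finrank k (gradedPiece J (t + d)) + Module.finrank k (gradedPiece K t) := by
  have hinj : Function.Injective (LinearMap.mulLeft k f) := mul_right_injective₀ hf0
  have h := Submodule.finrank_sup_add_finrank_inf_eq (gradedPiece J (t + d))
    ((gradedPiece K t).map (LinearMap.mulLeft k f))
  have hsup : gradedPiece J (t + d) ⊔ (gradedPiece K t).map (LinearMap.mulLeft k f) =
      gradedPiece (J ⊔ Ideal.span {f} * K) (t + d) := by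
    refine le_antisymm (sup_le (fun p hp ↦ ?_) ?_) fun p hp ↦ ?_
    · rw [mem_gradedPiece] at hp ⊢
      exact ⟨hp.1, Ideal.mem_sup_left hp.2⟩
    · rintro _ ⟨g, hg, rfl⟩
      have hg := mem_gradedPiece.mp hg
      rw [mem_gradedPiece, LinearMap.mulLeft_apply]
      exact ⟨by rw [add_comm t d]; exact hf.mul hg.1,
        Ideal.mem_sup_right (Ideal.mul_mem_mul (Ideal.mem_span_singleton_self f) hg.2)⟩
    · rw [mem_gradedPiece] at hp
      obtain ⟨j, hj, z, hz, hjz⟩ := Submodule.mem_sup.mp hp.2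
      obtain ⟨g, hg, rfl⟩ := Ideal.mem_span_singleton_mul.mp hz
      rw [← homogeneousComponent_eq_self hp.1, ← hjz, map_add,
        homogeneousComponent_mul_of_isHomogeneous hf, if_pos (Nat.le_add_left d t),
        Nat.add_sub_cancel]
      exact Submodule.add_mem_sup
        (mem_gradedPiece.mpr ⟨homogeneousComponent_isHomogeneous _ _,
          homogeneousComponent_mem_of_mem hJ hj _⟩)
        ⟨_, mem_gradedPiece.mpr ⟨homogeneousComponent_isHomogeneous _ _,
          homogeneousComponent_mem_of_mem hK hg _⟩, rfl⟩
  have hinf : gradedPiece J (t + d) ⊓ (gradedPiece K t).map (LinearMap.mulLeft k f) =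
      (gradedPiece J t).map (LinearMap.mulLeft k f) := by
    refine le_antisymm ?_ ?_
    · rintro _ ⟨hp, g, hg, rfl⟩
      have hg := mem_gradedPiece.mp hg
      exact ⟨g, mem_gradedPiece.mpr ⟨hg.1, hreg g (mem_gradedPiece.mp hp).2⟩, rfl⟩
    · rintro _ ⟨g, hg, rfl⟩
      have hg := mem_gradedPiece.mp hg
      refine ⟨mem_gradedPiece.mpr ⟨?_, J.mul_mem_left f hg.2⟩, g,
        mem_gradedPiece.mpr ⟨hg.1, hJK hg.2⟩, rfl⟩
      rw [LinearMap.mulLeft_apply, add_comm t d]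
      exact hf.mul hg.1
  rwa [hsup, hinf, ← (Submodule.equivMapOfInjective _ hinj _).finrank_eq,
    ← (Submodule.equivMapOfInjective _ hinj _).finrank_eq] at h

theorem gradedPiece_basicDoubleLink_of_lt {J K : Ideal (MvPolynomial (Fin (n + 1)) k)}
    {f : MvPolynomial (Fin (n + 1)) k} {d : ℕ} (hf : f.IsHomogeneous d)
    (hJ : J.IsHomogeneous (homogeneousSubmodule (Fin (n + 1)) k)) {t : ℕ} (ht : t < d) :
    gradedPiece (J ⊔ Ideal.span {f} * K) t = gradedPiece J t := by
  ext p
  rw [mem_gradedPiece, mem_gradedPiece]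
  refine and_congr_right fun hp ↦ ⟨fun h ↦ ?_, fun h ↦ Ideal.mem_sup_left h⟩
  obtain ⟨j, hj, z, hz, hjz⟩ := Submodule.mem_sup.mp h
  obtain ⟨g, hg, rfl⟩ := Ideal.mem_span_singleton_mul.mp hz
  rw [← homogeneousComponent_eq_self hp, ← hjz, map_add,
    homogeneousComponent_mul_of_isHomogeneous hf, if_neg (by lia), add_zero]
  exact homogeneousComponent_mem_of_mem hJ hj _

theorem hilbertFunction_basicDoubleLink {J K : Ideal (MvPolynomial (Fin (n + 1)) k)}
    {f : MvPolynomial (Fin (n + 1)) k} {d : ℕ} (hf : f.IsHomogeneous d) (hf0 : f ≠ 0)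
    (hJ : J.IsHomogeneous (homogeneousSubmodule (Fin (n + 1)) k))
    (hK : K.IsHomogeneous (homogeneousSubmodule (Fin (n + 1)) k)) (hJK : J ≤ K)
    (hreg : ∀ g, f * g ∈ J → g ∈ J) (t : ℤ) :
    hilbertFunction (J ⊔ Ideal.span {f} * K) t =
      (hilbertFunction J t - hilbertFunction J (t - d)) + hilbertFunction K (t - d) := by
  rcases lt_or_ge t d with htd | htd
  · rw [hilbertFunction_of_neg _ (by lia : t - d < 0), hilbertFunction_of_neg _ (by lia : t - d < 0),
      sub_zero, add_zero]
    rcases lt_or_ge t 0 with ht | ht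
    · rw [hilbertFunction_of_neg _ ht, hilbertFunction_of_neg _ ht]
    · lift t to ℕ using ht
      rw [hilbertFunction_natCast, hilbertFunction_natCast,
        gradedPiece_basicDoubleLink_of_lt hf hJ (by exact_mod_cast htd)]
  · obtain ⟨u, rfl⟩ : ∃ u : ℕ, t = (u + d : ℕ) := ⟨(t - d).toNat, by lia⟩
    have h := finrank_gradedPiece_basicDoubleLink hf hf0 hJ hK hJK hreg u
    have h1 : ((u + d : ℕ) : ℤ) - d = u := by push_cast; ring
    rw [h1]
    simp only [hilbertFunction_natCast]
    zify at h
    linarith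

theorem productIdeal_isHomogeneous {ι : Type*} {f : ι → MvPolynomial (Fin (n + 1)) k} {d : ι → ℕ}
    {T : Finset ι} (hf : ∀ i ∈ T, (f i).IsHomogeneous (d i)) (c : ℕ) :
    (productIdeal f T c).IsHomogeneous (homogeneousSubmodule (Fin (n + 1)) k) := by
  refine Ideal.homogeneous_span _ _ ?_
  rintro _ ⟨A, hA, rfl⟩
  exact ⟨∑ i ∈ A, d i, IsHomogeneous.prod A f d
    fun i hi ↦ hf i ((Finset.mem_powersetCard.mp hA).1 hi)⟩

theorem IsRegularFamily.ne_zero {R ι : Type*} [CommRing R] [Nontrivial R] {f : ι → R}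
    {T : Finset ι} {c : ℕ} (h : IsRegularFamily f T c ⊥) {a : ι} (ha : a ∈ T) : f a ≠ 0 := by
  intro h0
  have := h ∅ (Finset.empty_subset T) (by simp) a ha (by simp) 1
  simp [h0] at this

theorem hilbertFunction_productIdeal_insert {ι : Type*} [DecidableEq ι]
    {f : ι → MvPolynomial (Fin (n + 1)) k} {d : ι → ℕ} {T : Finset ι} {a : ι} {c : ℕ}
    (ha : a ∉ T) (hf : ∀ i ∈ insert a T, (f i).IsHomogeneous (d i))
    (h : IsRegularFamily f (insert a T) c ⊥) (t : ℤ) :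
    hilbertFunction (productIdeal f (insert a T) (c + 1)) t =
      (hilbertFunction (productIdeal f T c) t - hilbertFunction (productIdeal f T c) (t - d a)) +
        hilbertFunction (productIdeal f T (c + 1)) (t - d a) := by
  have hfT : ∀ i ∈ T, (f i).IsHomogeneous (d i) := fun i hi ↦ hf i (Finset.mem_insert_of_mem hi)
  rw [productIdeal_insert f ha]
  exact hilbertFunction_basicDoubleLink (hf a (Finset.mem_insert_self a T))
    (h.ne_zero (Finset.mem_insert_self a T))
    (productIdeal_isHomogeneous hfT c) (productIdeal_isHomogeneous hfT (c + 1))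
    (productIdeal_le_succ f T c) (fun g hg ↦ mem_productIdeal_of_mul_mem ha h hg) t

/-- Stars and bars: monomials of degree `t` are multisets of `t` variables. -/
theorem finrank_homogeneousSubmodule (t : ℕ) :
    Module.finrank k (homogeneousSubmodule (Fin (n + 1)) k t) = (t + n).choose n := by
  rw [homogeneousSubmodule_eq_finsupp_supported,
    Module.finrank_eq_nat_card_basis (Module.Basis.ofRepr (AddMonoidAlgebra.supportedEquivFinsupp _))]
  have e : {d : Fin (n + 1) →₀ ℕ | d.degree = t} ≃ Sym (Fin (n + 1)) t :=
    (Equiv.subtypeEquivRight fun _ ↦ Iff.rfl).trans (Sym.equivNatSum (Fin (n + 1)) t).symm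
  rw [Nat.card_congr e, Nat.card_eq_fintype_card, Sym.card_sym_eq_choose, Fintype.card_fin,
    ← Nat.choose_symm_of_eq_add (a := t) (b := n) (by lia)]
  congr 1
  lia

end HilbertFunction

/-! ### Hilbert polynomials and the degree. -/

section Degree

variable {k : Type*} [Field k] {n : ℕ}

/-- The Hilbert polynomial of `I` has degree at most `r`, with coefficient `e / r!` at `t ^ r`. -/
def HasHilbertPolynomial (I : Ideal (MvPolynomial (Fin (n + 1)) k)) (r e : ℕ) : Prop :=
  ∃ P : Polynomial ℚ, (∀ᶠ t : ℕ in Filter.atTop, (hilbertFunction I t : ℚ) = P.eval (t : ℚ)) ∧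
    P.natDegree ≤ r ∧ P.coeff r * (r.factorial : ℚ) = e

/-- The bound on the degree admits `e = 0`, as needed for the empty scheme in the induction; `e ≠ 0`
makes the bound an equality. -/
theorem HasHilbertPolynomial.hasDegree {I : Ideal (MvPolynomial (Fin (n + 1)) k)} {r e : ℕ}
    (h : HasHilbertPolynomial I r e) (he : e ≠ 0) : HasDegree I e := by
  obtain ⟨P, hP, hdeg, hcoeff⟩ := h
  have hne : P.coeff r ≠ 0 := by
    intro h0
    rw [h0, zero_mul] at hcoeff
    exact he (by exact_mod_cast hcoeff.symm)
  have : P.natDegree = r := le_antisymm hdeg (Polynomial.le_natDegree_of_ne_zero hne)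
  exact ⟨P, hP, by rw [Polynomial.leadingCoeff, this, hcoeff]⟩

theorem coeff_taylor_of_natDegree_le_succ {P : Polynomial ℚ} {m : ℕ} (hP : P.natDegree ≤ m + 1)
    (r : ℚ) : (Polynomial.taylor r P).coeff m = P.coeff m + (m + 1) * r * P.coeff (m + 1) := by
  rw [Polynomial.taylor_coeff, Polynomial.hasseDeriv_apply,
    Polynomial.sum_over_range' _ (by simp) (m + 2) (by lia), Finset.sum_range_succ,
    Finset.sum_range_succ, Finset.sum_eq_zero fun i hi ↦ ?_]
  · simp [Nat.choose_succ_self_right]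
    ring
  · rw [Nat.choose_eq_zero_of_lt (Finset.mem_range.mp hi)]
    simp

theorem coeff_taylor_of_natDegree_le {P : Polynomial ℚ} {m : ℕ} (hP : P.natDegree ≤ m)
    (r : ℚ) : (Polynomial.taylor r P).coeff m = P.coeff m := by
  have h := hP.eq_or_lt
  rcases h with rfl | h
  · have h1 := Polynomial.natDegree_taylor P r
    have h2 := Polynomial.leadingCoeff_taylor (r := r) (f := P)
    rwa [Polynomial.leadingCoeff, h1] at h2
  · rw [Polynomial.coeff_eq_zero_of_natDegree_lt h,
      Polynomial.coeff_eq_zero_of_natDegree_lt (by rwa [Polynomial.natDegree_taylor])]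

/-- In `P(t) - P(t - d)` the terms of degree `r + 1` cancel and `t ^ r` has coefficient `(r + 1) d`
times that of `t ^ (r + 1)` in `P`; the factor `r + 1` turns `r!` into `(r + 1)!`. -/
theorem HasHilbertPolynomial.of_recursion {I J K : Ideal (MvPolynomial (Fin (n + 1)) k)}
    {r d eJ eK : ℕ} (hJ : HasHilbertPolynomial J (r + 1) eJ) (hK : HasHilbertPolynomial K r eK)
    (h : ∀ t : ℤ, hilbertFunction I t =
      (hilbertFunction J t - hilbertFunction J (t - d)) + hilbertFunction K (t - d)) :
    HasHilbertPolynomial I r (d * eJ + eK) := by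
  obtain ⟨P, hP, hPdeg, hPe⟩ := hJ
  obtain ⟨Q, hQ, hQdeg, hQe⟩ := hK
  have hcoeff : (P - Polynomial.taylor (-(d : ℚ)) P + Polynomial.taylor (-(d : ℚ)) Q).coeff r =
      (r + 1) * d * P.coeff (r + 1) + Q.coeff r := by
    rw [Polynomial.coeff_add, Polynomial.coeff_sub, coeff_taylor_of_natDegree_le_succ hPdeg,
      coeff_taylor_of_natDegree_le hQdeg]
    ring
  refine ⟨P - Polynomial.taylor (-(d : ℚ)) P + Polynomial.taylor (-(d : ℚ)) Q, ?_, ?_, ?_⟩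
  · have hP' := (Filter.tendsto_sub_atTop_nat d).eventually hP
    have hQ' := (Filter.tendsto_sub_atTop_nat d).eventually hQ
    filter_upwards [hP, hP', hQ', Filter.eventually_ge_atTop d] with t h1 h2 h3 htd
    rw [Nat.cast_sub htd, Nat.cast_sub htd] at h2 h3
    rw [h t]
    push_cast
    rw [h1, h2, h3, Polynomial.eval_add, Polynomial.eval_sub, Polynomial.taylor_eval,
      Polynomial.taylor_eval, sub_eq_add_neg (t : ℚ)]
  · refine Polynomial.natDegree_le_iff_coeff_eq_zero.mpr fun m hm ↦ ?_
    have hQ0 : (Polynomial.taylor (-(d : ℚ)) Q).coeff m = 0 :=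
      Polynomial.coeff_eq_zero_of_natDegree_lt (by rw [Polynomial.natDegree_taylor]; lia)
    rw [Polynomial.coeff_add, Polynomial.coeff_sub, hQ0,
      coeff_taylor_of_natDegree_le (hPdeg.trans hm), sub_self, add_zero]
  · rw [hcoeff]
    push_cast
    rw [← hPe, ← hQe, Nat.factorial_succ]
    push_cast
    ring

theorem hasHilbertPolynomial_bot :
    HasHilbertPolynomial (⊥ : Ideal (MvPolynomial (Fin (n + 1)) k)) n 1 := by
  refine ⟨Polynomial.preHilbertPoly ℚ n 0, Filter.Eventually.of_forall fun t ↦ ?_,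
    (Polynomial.natDegree_preHilbertPoly ℚ n 0).le, ?_⟩
  · have : gradedPiece (⊥ : Ideal (MvPolynomial (Fin (n + 1)) k)) t = ⊥ := by
      ext p
      rw [mem_gradedPiece, Submodule.mem_bot, Submodule.mem_bot]
      exact ⟨And.right, fun h ↦ ⟨h ▸ isHomogeneous_zero _ _ _, h⟩⟩
    rw [hilbertFunction_natCast, this, finrank_bot, finrank_homogeneousSubmodule,
      Polynomial.preHilbertPoly_eq_choose_sub_add ℚ n (Nat.zero_le t)]
    simp
  · rw [Polynomial.coeff_preHilbertPoly_self]
    have : (n.factorial : ℚ) ≠ 0 := by exact_mod_cast n.factorial_ne_zero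
    simp [this]

theorem hasHilbertPolynomial_top (r : ℕ) :
    HasHilbertPolynomial (⊤ : Ideal (MvPolynomial (Fin (n + 1)) k)) r 0 := by
  refine ⟨0, Filter.Eventually.of_forall fun t ↦ ?_, by simp, by simp⟩
  have : gradedPiece (⊤ : Ideal (MvPolynomial (Fin (n + 1)) k)) t =
      homogeneousSubmodule (Fin (n + 1)) k t := by
    ext p
    simp [mem_gradedPiece]
  rw [hilbertFunction_natCast, this]
  simp

/-- The degrees obey the recursion of elementary symmetric polynomials, `e_{c+1}(T ∪ {a}) = d_a
e_c(T) + e_{c+1}(T)`. -/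
theorem hasHilbertPolynomial_productIdeal {ι : Type*}
    {f : ι → MvPolynomial (Fin (n + 1)) k} {d : ι → ℕ} {T : Finset ι} {c r : ℕ} (hr : r + c = n)
    (hf : ∀ i ∈ T, (f i).IsHomogeneous (d i)) (h : IsRegularFamily f T c ⊥) :
    HasHilbertPolynomial (productIdeal f T c) r
      (∑ A ∈ T.powersetCard c, ∏ i ∈ A, d i) := by
  classical
  induction T using Finset.induction_on generalizing c r with
  | empty =>
    cases c with
    | zero =>
      rw [add_zero] at hr
      subst hr
      rw [productIdeal_zero]
      simpa using hasHilbertPolynomial_bot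
    | succ c =>
      rw [productIdeal_of_card_lt f (by simp), Finset.powersetCard_eq_empty.mpr (by simp)]
      exact hasHilbertPolynomial_top r
  | insert a T ha ih =>
    cases c with
    | zero =>
      rw [add_zero] at hr
      subst hr
      rw [productIdeal_zero]
      simpa using hasHilbertPolynomial_bot
    | succ c =>
      have hfT : ∀ i ∈ T, (f i).IsHomogeneous (d i) := fun i hi ↦
        hf i (Finset.mem_insert_of_mem hi)
      have hJ := ih (c := c) (r := r + 1) (by lia) hfT
        (h.mono (Finset.subset_insert a T) (Nat.le_succ c))
      have hK := ih (c := c + 1) (r := r) hr hfT (h.mono (Finset.subset_insert a T) le_rfl)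
      have hI := hJ.of_recursion hK (hilbertFunction_productIdeal_insert ha hf
        (h.mono subset_rfl (Nat.le_succ c)))
      convert! hI using 1
      rw [Finset.powersetCard_succ_insert ha, Finset.sum_union, add_comm, Finset.sum_image,
        Finset.mul_sum]
      · congr 1
        refine Finset.sum_congr rfl fun A hA ↦ ?_
        rw [Finset.prod_insert fun h ↦ ha ((Finset.mem_powersetCard.mp hA).1 h)]
      · intro A hA B hB hAB
        have hA := fun h ↦ ha ((Finset.mem_powersetCard.mp hA).1 h)
        have hB := fun h ↦ ha ((Finset.mem_powersetCard.mp hB).1 h)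
        rw [← Finset.erase_insert hA, ← Finset.erase_insert hB, hAB]
      · refine Finset.disjoint_left.mpr fun A hA hA' ↦ ?_
        obtain ⟨B, -, rfl⟩ := Finset.mem_image.mp hA'
        exact ha ((Finset.mem_powersetCard.mp hA).1 (Finset.mem_insert_self a B))

end Degree

/-! ### The Cohen-Macaulay property. -/

section CohenMacaulay

open RingTheory.Sequence

theorem IsRegularFamily.exists_isWeaklyRegular {R ι : Type*} [CommRing R] {f : ι → R}
    {A : Finset ι} (h : IsRegularFamily f A A.card ⊥) :
    ∃ rs : List R, rs.length = A.card ∧ Ideal.ofList rs = Ideal.span (f '' (A : Set ι)) ∧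
      IsWeaklyRegular R rs := by
  classical
  induction A using Finset.induction_on with
  | empty => exact ⟨[], by simp, by simp, IsWeaklyRegular.nil _ _⟩
  | insert a A ha ih =>
    obtain ⟨rs, hlen, hspan, hreg⟩ :=
      ih (h.mono (Finset.subset_insert a A) (Finset.card_le_card (Finset.subset_insert a A)))
    refine ⟨rs ++ [f a], ?_, ?_, ?_⟩
    · rw [Finset.card_insert_of_notMem ha, List.length_append, hlen, List.length_singleton]
    · rw [Ideal.ofList_append, Ideal.ofList_singleton, hspan, Finset.coe_insert,
        Set.image_insert_eq, Ideal.span_insert, sup_comm]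
    · rw [isWeaklyRegular_append_iff, isWeaklyRegular_singleton_iff]
      refine ⟨hreg, (isSMulRegular_quotient_iff_mem_of_smul_mem _ _).mpr fun g hg ↦ ?_⟩
      rw [smul_eq_mul, Ideal.mul_top, hspan] at hg ⊢
      have := h A (Finset.subset_insert a A) (Finset.card_le_card (Finset.subset_insert a A)) a
        (Finset.mem_insert_self a A) ha g
      rw [bot_sup_eq] at this
      exact this hg

/-- A prime containing the intersection contains one of the complete intersection ideals, hence a
regular sequence of length `c`. -/
theorem card_le_height_productIdeal {R ι : Type*} [CommRing R] [IsNoetherianRing R] {f : ι → R}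
    {T : Finset ι} {c : ℕ} (h : IsRegularFamily f T c ⊥) :
    (c : ℕ∞) ≤ (productIdeal f T c).height := by
  rw [Ideal.height_eq_inf_minimalPrimes]
  refine le_iInf₂ fun Q hQ ↦ ?_
  have hQp : Q.IsPrime := hQ.1.1
  have hle := hQ.1.2
  rw [productIdeal_eq_iInf h, ← Finset.inf_eq_iInf] at hle
  obtain ⟨A, hA, hAQ⟩ := (Ideal.IsPrime.inf_le' hQp).mp hle
  obtain ⟨hAT, rfl⟩ := Finset.mem_powersetCard.mp hA
  obtain ⟨rs, hlen, hspan, hreg⟩ := (h.mono hAT le_rfl).exists_isWeaklyRegular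
  rw [← hlen]
  refine length_le_height_of_isWeaklyRegular (fun r hr ↦ hAQ ?_) hreg
  rw [← hspan]
  exact Ideal.subset_span hr

theorem depth_le_height {A : Type*} [CommRing A] [IsNoetherianRing A] (P : Ideal A) [P.IsPrime] :
    depth P ≤ P.height :=
  iSup_le fun _ ↦ iSup₂_le fun hmem hreg ↦
    length_le_height_of_isWeaklyRegular hmem hreg.toIsWeaklyRegular

theorem le_depth_of_extVanishes {R : Type*} [CommRing R] [IsNoetherianRing R] {I : Ideal R}
    {P : Ideal (R ⧸ I)} (hP : P ≠ ⊤) {r : ℕ}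
    (h : ExtVanishes (P.comap (Ideal.Quotient.mk I)) r (ModuleCat.of R (R ⧸ I))) :
    (r : ℕ∞) ≤ depth P := by
  have hIP : I ≤ P.comap (Ideal.Quotient.mk I) := fun x hx ↦ by
    rw [Ideal.mem_comap, Ideal.Quotient.eq_zero_iff_mem.mpr hx]
    exact P.zero_mem
  obtain ⟨rs, rfl, hmem, hreg⟩ := h.exists_isRegular (Ideal.comap_ne_top _ hP) hIP
  have hmem' : ∀ x ∈ rs.map (algebraMap R (R ⧸ I)), x ∈ P := by
    intro x hx
    obtain ⟨y, hy, rfl⟩ := List.mem_map.mp hx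
    exact hmem y hy
  have hreg' : IsRegular (R ⧸ I) (rs.map (algebraMap R (R ⧸ I))) := by
    refine ⟨(isWeaklyRegular_map_algebraMap_iff _ _ _).mpr hreg.toIsWeaklyRegular, fun htop ↦ ?_⟩
    have : (⊤ : Ideal (R ⧸ I)) ≤ P := by
      rw [htop, smul_eq_mul, Ideal.mul_top]
      exact Ideal.span_le.mpr hmem'
    exact hP (top_le_iff.mp this)
  refine le_trans ?_ (le_iSup_of_le _ (le_iSup₂_of_le hmem' hreg' le_rfl))
  rw [List.length_map]

/-- At each maximal ideal of the quotient, `n + 1 - c` bounds the depth from below and the height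
from above. -/
theorem isCohenMacaulayRing_productIdeal {k ι : Type*} [Field k] {n : ℕ}
    {f : ι → MvPolynomial (Fin (n + 1)) k} {T : Finset ι} {c : ℕ} (hcn : c ≤ n + 1)
    (h : IsRegularFamily f T c ⊥) :
    IsCohenMacaulayRing (MvPolynomial (Fin (n + 1)) k ⧸ productIdeal f T c) := by
  refine ⟨inferInstance, fun P hP ↦ le_antisymm (depth_le_height P) ?_⟩
  have hmax := Ideal.comap_isMaximal_of_surjective (Ideal.Quotient.mk (productIdeal f T c))
    Ideal.Quotient.mk_surjective (K := P)
  refine le_trans ?_ (le_depth_of_extVanishes hP.ne_top (r := n + 1 - c)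
    (extVanishes_productIdeal h ((extVanishes_of_isMaximal hmax).mono (by lia))))
  have h1 := height_ker_add_height_le (φ := Ideal.Quotient.mk (productIdeal f T c))
    Ideal.Quotient.mk_surjective P
  rw [Ideal.mk_ker] at h1
  have h2 := (add_le_add_left (card_le_height_productIdeal h) P.height).trans
    (h1.trans (height_le_of_isPrime _))
  lift P.height to ℕ using (by
    intro htop
    rw [htop, add_top] at h2
    exact absurd h2 (by simp [-Nat.cast_add])) with m
  have h3 : c + m ≤ n + 1 := by exact_mod_cast h2
  exact_mod_cast (by lia : m ≤ n + 1 - c)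

end CohenMacaulay

end HypersurfaceConfig

/-! ### The main theorem. -/

open HypersurfaceConfig in
theorem mainTheorem5 {k : Type*} [Field k] [Infinite k] (n s c : ℕ)
    (hc1 : 1 ≤ c) (hcn : c ≤ n) (hcs : c ≤ s)
    (d : ℕ → ℕ) (hd : ∀ i ∈ Finset.Icc 1 s, 1 ≤ d i)
    (f : ℕ → MvPolynomial (Fin (n + 1)) k)
    (hf : ∀ i ∈ Finset.Icc 1 s, (f i).IsHomogeneous (d i))
    -- any `c + 1` (all `c`, if `s = c`) of the hypersurfaces meet in the expected codimension
    (hcodim : ∀ A ⊆ Finset.Icc 1 s, A.card = min (c + 1) s →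
      (HypersurfaceConfig.intersectionIdeal f A).height = (A.card : ℕ∞)) :
    -- `V_{λ,c}` is arithmetically Cohen-Macaulay
    HypersurfaceConfig.IsCohenMacaulayRing
        (MvPolynomial (Fin (n + 1)) k ⧸ HypersurfaceConfig.configIdeal f s c) ∧
    -- the recursion for the Hilbert function
    (∀ t : ℤ,
      HypersurfaceConfig.hilbertFunction (HypersurfaceConfig.configIdeal f s c) t =
        (HypersurfaceConfig.hilbertFunction
            (HypersurfaceConfig.configIdeal f (s - 1) (c - 1)) t -
          HypersurfaceConfig.hilbertFunction
            (HypersurfaceConfig.configIdeal f (s - 1) (c - 1)) (t - d s)) +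
        HypersurfaceConfig.hilbertFunction
          (HypersurfaceConfig.configIdeal f (s - 1) c) (t - d s)) ∧
    -- the degree
    HypersurfaceConfig.HasDegree (HypersurfaceConfig.configIdeal f s c)
      (∑ A ∈ (Finset.Icc 1 s).powersetCard c, ∏ i ∈ A, d i) ∧
    -- the products of `s - c + 1` of the forms generate the ideal
    HypersurfaceConfig.configIdeal f s c =
      Ideal.span ((fun A : Finset ℕ => ∏ i ∈ A, f i) ''
        {A | A ∈ (Finset.Icc 1 s).powersetCard (s - c + 1)}) ∧
    -- and none of these products is redundant
    (∀ A ∈ (Finset.Icc 1 s).powersetCard (s - c + 1),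
      ∏ i ∈ A, f i ∉ Ideal.span ((fun B : Finset ℕ => ∏ i ∈ B, f i) ''
        {B | B ∈ (Finset.Icc 1 s).powersetCard (s - c + 1) ∧ B ≠ A})) := by
  have hfm : ∀ i ∈ Finset.Icc 1 s, f i ∈ irrelevantIdeal k n := fun i hi ↦
    mem_irrelevantIdeal_of_isHomogeneous (hf i hi) (hd i hi)
  have hcard : (Finset.Icc 1 s).card = s := by simp
  have hreg : IsRegularFamily f (Finset.Icc 1 s) c ⊥ :=
    isRegularFamily_of_height_eq hcn hf hd fun A hA hAc ↦ hcodim A hA (by rwa [hcard] at hAc)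
  have hI := configIdeal_eq_productIdeal hcn hfm hreg
  refine ⟨?_, fun t ↦ ?_, ?_, ?_, fun A hA ↦ ?_⟩
  · rw [hI]
    exact isCohenMacaulayRing_productIdeal (by lia) hreg
  · obtain ⟨c, rfl⟩ : ∃ c', c = c' + 1 := ⟨c - 1, by lia⟩
    obtain ⟨s, rfl⟩ : ∃ s', s = s' + 1 := ⟨s - 1, by lia⟩
    have hIcc : Finset.Icc 1 (s + 1) = insert (s + 1) (Finset.Icc 1 s) :=
      (Finset.insert_Icc_right_eq_Icc_add_one (by lia)).symm
    have hsub : Finset.Icc 1 s ⊆ Finset.Icc 1 (s + 1) := Finset.Icc_subset_Icc_right (Nat.le_succ s)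
    rw [Nat.add_sub_cancel, Nat.add_sub_cancel, hI,
      configIdeal_eq_productIdeal (by lia) (fun i hi ↦ hfm i (hsub hi))
        (hreg.mono hsub (Nat.le_succ c)),
      configIdeal_eq_productIdeal hcn (fun i hi ↦ hfm i (hsub hi)) (hreg.mono hsub le_rfl), hIcc]
    rw [hIcc] at hf hreg
    exact hilbertFunction_productIdeal_insert (by simp) hf (hreg.mono subset_rfl (Nat.le_succ c)) t
  · rw [hI]
    refine (hasHilbertPolynomial_productIdeal (r := n - c) (by lia) hf hreg).hasDegree ?_
    -- The sum is nonempty as `c ≤ s`, and its terms are positive as all `d i ≥ 1`; this is the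
    -- nonvanishing that `HasHilbertPolynomial.hasDegree` needs.
    have hpos : 0 < ∑ A ∈ (Finset.Icc 1 s).powersetCard c, ∏ i ∈ A, d i := by
      refine Finset.sum_pos (fun A hA ↦ Finset.prod_pos fun i hi ↦
        hd i ((Finset.mem_powersetCard.mp hA).1 hi)) (Finset.powersetCard_nonempty.mpr ?_)
      rwa [hcard]
    exact hpos.ne'
  · rw [hI, productIdeal, hcard, Nat.sub_add_comm hcs]
  · refine prod_notMem_span_prod hA (by rw [hcard]; lia) hreg fun htop ↦ ?_
    exact irrelevantIdeal_isMaximal.ne_top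
      (top_le_iff.mp (htop ▸ span_image_le_irrelevantIdeal hfm))
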